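/- **Setting.** Fix $\theta\in\mathbb R$ and, on the plane cut along the ray $e^{\mathsf i\theta}\mathbb R_{\ge 0}$, the branch of $\log$ with imaginary part in $(\theta-2\pi,\theta)$. It is used for $\log\lambda$ and for the powers of $\lambda-u^i$ below. (The standard choice is $\theta=\pi/2$: then $\log 1=0$ and the cut is $\mathsf i\mathbb R_{\ge0}$.) Let $t=(t^1,t^2)\in\mathbb C\times\mathbb C^*$ with $t^2\notin e^{2\mathsf i\theta}\mathbb R_{\ge0}$, let $\log t^2$ be the branch with imaginary part in $(2\theta-2\pi,2\theta)$, and put $(t^2)^s=\exp(s\log t^2)$. (For $\theta=\pi/2$ this is $t^2\notin\mathbb R_{\le 0}$ with the principal branch; for $\theta=\pi$ it is $t^2\notin\mathbb R_{\ge0}$ with $\log(-1)=\pi\mathsf i$. These two charts cover $\mathbb C\times\mathbb C^*$.) Put $$\mu=\begin{pmatrix}\tfrac12&0\\0&-\tfrac12\end{pmatrix},\quad \mathcal U=\begin{pmatrix}t^1&2\\2t^2&t^1\end{pmatrix},\quad R=\begin{pmatrix}0&2\\0&0\end{pmatrix},\quad \Psi^{-1}=\tfrac1{\sqrt2}\begin{pmatrix}(t^2)^{-1/4}&\mathsf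 i(t^2)^{-1/4}\\(t^2)^{1/4}&-\mathsf i(t^2)^{1/4}\end{pmatrix},$$ $u^1=t^1+2\sqrt{t^2}$ and $u^2=t^1-2\sqrt{t^2}$. Fix $\psi\in\mathbb C$. The calibration is $S(t,z)=\sum_{k\ge0}S_kz^{-k}$ with $S_0=\mathbf 1$, $(S_1)_{1,2}=\psi+\log t^2$ and $kS_k+S_k\mu-\mu S_k=\mathcal US_{k-1}-S_{k-1}R$ for $k\ge1$. For $i=1,2$ and $l\in\mathbb Z$ the period vector $I^{(l)}_{e_i}(t,\lambda)\in\mathbb C^2$ is the holomorphic solution on $\mathbb C\setminus\bigcup_j(u^j+e^{\mathsf i\theta}\mathbb R_{\ge0})$ of $$(\mathcal U-\lambda)\,\partial_\lambda I=(\mu+l+\tfrac12)\,I$$ such that $$I^{(l)}_{e_i}=\tfrac{(-1)^l}{\sqrt{2\pi}}\,\Gamma(l+\tfrac12)\,(\lambda-u^i)^{-l-\frac12}\big(\Psi^{-1}e_i+O(\lambda-u^i)\big)\qquad(\lambda\to u^i),$$ and such that its analytic continuation along a small counterclockwise loop around $u^i$ is $-I^{(l)}_{e_i}$. For $a=(a_1,a_2)\in\mathbb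 C^2$ let $I^{(l)}_a=a_1I^{(l)}_{e_1}+a_2I^{(l)}_{e_2}$ and $\mathfrak f_a(t,\lambda,z)=\sum_{l\in\mathbb Z}I_a^{(l)}(t,\lambda)(-z)^l$, a formal series in $z^{\pm1}$. Let $$\mathfrak f_{e_1,\infty}(\lambda,z)=\sum_{l\in\mathbb Z}\begin{pmatrix}\partial_\lambda^{l+1}\big(\log\lambda+\tfrac\psi2\big)\\ \partial_\lambda^l\,\tfrac12\end{pmatrix}(-z)^l,\qquad \mathfrak f_{e_2,\infty}=\mathfrak f_{e_1,\infty}+\sum_{l\in\mathbb Z}\begin{pmatrix}\partial_\lambda^{l+1}(\pi\mathsf i)\\0\end{pmatrix}(-z)^l,$$ and $\mathfrak f_{a,\infty}=a_1\mathfrak f_{e_1,\infty}+a_2\mathfrak f_{e_2,\infty}$. Here negative powers of $\partial_\lambda$ are iterated formal integrations without constants: $\partial_\lambda^{-1}\lambda^{-1}=\log\lambda$, $\partial_\lambda^{-1}\lambda^k=\frac{\lambda^{k+1}}{k+1}$ for $k\neq-1$, and $\partial_\lambda^{-1}(\lambda^p\log\lambda)=\frac{\lambda^{p+1}}{p+1}\big(\log\lambda-\frac1{p+1}\big)$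 for $p\ge0$. **Proposition.** The period vectors exist, and for every $a\in\mathbb C^2$ $$\mathfrak f_a(t,\lambda,z)\sim S(t,z)\,\mathfrak f_{a,\infty}(\lambda,z)\qquad\text{as }|\lambda|\to\infty,\ \arg\lambda\neq\theta$$ (so $\arg\lambda\ne\pi/2$ for the standard choice), as an asymptotic expansion of each coefficient in $z$. Explicitly, let $f_n(\lambda)$ and $g_n(\lambda)$ be the coefficients of $z^n$ in $\mathfrak f_a$ and $\mathfrak f_{a,\infty}$. Then for all $n\in\mathbb Z$, $K\ge0$ and $\delta>0$, $$f_n(\lambda)-\sum_{k=0}^{K-1}S_k\,g_{n+k}(\lambda)=O\big(|\lambda|^{-(n+K)}\big)$$ as $|\lambda|\to\infty$ in the sector $\theta-2\pi+\delta\le\arg\lambda\le\theta-\delta$. -/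

import Mathlib

open Complex Filter Topology Asymptotics

noncomputable section

namespace Catalan

/-- Two-component complex column vectors. Index `0` is the first component, index `1` the second. -/
abbrev C2 : Type := Fin 2 → ℂ

/-! ### Cuts and branches of the logarithm -/

/-- The complex plane cut along the closed ray from `0` in the direction `exp (θ i)`. -/
def cutPlane (θ : ℝ) : Set ℂ := {w | ¬ ∃ r : ℝ, 0 ≤ r ∧ w = r * exp (θ * I)}

/-- The branch of the logarithm on `cutPlane θ` with imaginary part in `(θ - 2π, θ)`.
For `θ = π` it is the principal branch; for `θ = π/2` it is the branch on the plane cut along the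
positive imaginary axis that vanishes at `1`; for `θ = 2π` it is the branch on the plane cut along
the positive real axis with value `π i` at `-1`. -/
def logBranch (θ : ℝ) (w : ℂ) : ℂ :=
  log (w * exp (-((θ - Real.pi : ℝ) : ℂ) * I)) + ((θ - Real.pi : ℝ) : ℂ) * I

/-! ### The Frobenius manifold

A point of `ℂ × ℂ*` is `(t₁, t₂)`. The number `θ` selects the chart `t₂ ∈ cutPlane (2 * θ)`,
in which the logarithm and the roots of `t₂` are taken from `logBranch (2 * θ)`.
The chart `θ = π/2` is `t₂ ∉ ℝ₋` with the principal branch, the chart `θ = π` is `t₂ ∉ ℝ₊`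
with `log (-1) = π i`. -/

/-- `log t₂` in the chart `θ`. -/
def logT (θ : ℝ) (t₂ : ℂ) : ℂ := logBranch (2 * θ) t₂

/-- The power `t₂ ^ s = exp (s log t₂)` in the chart `θ`. -/
def powT (θ : ℝ) (t₂ s : ℂ) : ℂ := exp (s * logT θ t₂)

/-- The canonical coordinates `u¹ = t₁ + 2 √t₂` and `u² = t₁ - 2 √t₂`. -/
def canon (θ : ℝ) (t₁ t₂ : ℂ) : Fin 2 → ℂ :=
  ![t₁ + 2 * powT θ t₂ (1 / 2), t₁ - 2 * powT θ t₂ (1 / 2)]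

/-- The matrix `μ`. -/
def muMat : Matrix (Fin 2) (Fin 2) ℂ := !![1 / 2, 0; 0, -(1 / 2)]

/-- The matrix of multiplication by the Euler vector field. -/
def UMat (t₁ t₂ : ℂ) : Matrix (Fin 2) (Fin 2) ℂ := !![t₁, 2; 2 * t₂, t₁]

/-- The nilpotent matrix `R` of the monodromy data at `z = ∞`. -/
def RMat : Matrix (Fin 2) (Fin 2) ℂ := !![0, 2; 0, 0]

/-- The transition matrix `Ψ⁻¹` from flat to normalised canonical components. -/
def PsiInv (θ : ℝ) (t₂ : ℂ) : Matrix (Fin 2) (Fin 2) ℂ :=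
  (1 / (Real.sqrt 2 : ℂ)) •
    !![powT θ t₂ (-(1 / 4)), I * powT θ t₂ (-(1 / 4));
       powT θ t₂ (1 / 4), -I * powT θ t₂ (1 / 4)]

/-! ### The calibration -/

/-- The coefficients `S_k` of the calibration `S = ∑ S_k z⁻ᵏ` with parameter `ψ`: `S_0 = 1`,
`(S_1)₁₂ = ψ + log t₂`, and all other entries are solved from
`k S_k + S_k μ - μ S_k = U S_{k-1} - S_{k-1} R`. -/
def calibration (θ : ℝ) (t₁ t₂ ψ : ℂ) : ℕ → Matrix (Fin 2) (Fin 2) ℂ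
  | 0 => 1
  | k + 1 => Matrix.of fun a b =>
      if k = 0 ∧ a = 0 ∧ b = 1 then ψ + logT θ t₂
      else (UMat t₁ t₂ * calibration θ t₁ t₂ ψ k - calibration θ t₁ t₂ ψ k * RMat) a b /
        ((k : ℂ) + 1 + muMat b b - muMat a a)

theorem calibration_zero (θ : ℝ) (t₁ t₂ ψ : ℂ) : calibration θ t₁ t₂ ψ 0 = 1 := rfl

theorem calibration_one (θ : ℝ) (t₁ t₂ ψ : ℂ) :
    calibration θ t₁ t₂ ψ 1 0 1 = ψ + logT θ t₂ := by
  simp [calibration]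

/-- The recursion that determines the calibration. -/
theorem calibration_rec (θ : ℝ) (t₁ t₂ ψ : ℂ) (k : ℕ) :
    ((k : ℂ) + 1) • calibration θ t₁ t₂ ψ (k + 1) + calibration θ t₁ t₂ ψ (k + 1) * muMat
        - muMat * calibration θ t₁ t₂ ψ (k + 1)
      = UMat t₁ t₂ * calibration θ t₁ t₂ ψ k - calibration θ t₁ t₂ ψ k * RMat := by
  have h1 : (k : ℂ) + 1 ≠ 0 := by exact_mod_cast Nat.succ_ne_zero k
  have h2 : (k : ℂ) + 1 + 1 ≠ 0 := by exact_mod_cast Nat.succ_ne_zero (k + 1)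
  have key : ∀ a b : Fin 2,
      ((k : ℂ) + 1 + muMat b b - muMat a a) * calibration θ t₁ t₂ ψ (k + 1) a b
        = (UMat t₁ t₂ * calibration θ t₁ t₂ ψ k - calibration θ t₁ t₂ ψ k * RMat) a b := by
    intro a b
    by_cases h : k = 0 ∧ a = 0 ∧ b = 1
    · obtain ⟨rfl, rfl, rfl⟩ := h
      simp [calibration, muMat, UMat, RMat]
      norm_num
    · have hne : (k : ℂ) + 1 + muMat b b - muMat a a ≠ 0 := by
        fin_cases a <;> fin_cases b <;> simp [muMat]
        · exact h1
        · have hk : k ≠ 0 := fun hk => h ⟨hk, rfl, rfl⟩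
          have : (k : ℂ) + 1 + -2⁻¹ - 2⁻¹ = k := by ring
          rw [this]; exact_mod_cast hk
        · have : (k : ℂ) + 1 + 2⁻¹ + 2⁻¹ = k + 1 + 1 := by ring
          rw [this]; exact h2
        · exact h1
      rw [calibration, Matrix.of_apply, if_neg h]
      field_simp
  ext a b
  rw [← key a b]
  simp only [Matrix.sub_apply, Matrix.add_apply, Matrix.smul_apply, Matrix.mul_apply (M := muMat),
    Matrix.mul_apply (N := muMat), Fin.sum_univ_two, smul_eq_mul]
  fin_cases a <;> fin_cases b <;> simp [muMat] <;> ring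

/-! ### The period vectors -/

/-- The `λ`-plane without the two rays from `u¹` and `u²` in the direction `exp (θ i)`. -/
def cutLambda (θ : ℝ) (t₁ t₂ : ℂ) : Set ℂ :=
  {x | ∀ i, x - canon θ t₁ t₂ i ∈ cutPlane θ}

/-- `per`, given on the cut `λ`-plane, is the period vector `I^{(l)}_{e_i}(t, ·)`: it solves
`(U - λ) I' = (μ + l + 1/2) I`, has the prescribed leading behaviour at `u^i`, and its analytic
continuation along a small counterclockwise loop around `u^i` is `-per`. In the last condition
the continuation of `per` to the universal cover of a small punctured disc around `u^i`
is the function `J` of `s = log (λ - u^i)`. -/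
structure IsPeriodVector (θ : ℝ) (t₁ t₂ : ℂ) (i : Fin 2) (l : ℤ) (per : ℂ → C2) : Prop where
  differentiableAt : ∀ x ∈ cutLambda θ t₁ t₂, DifferentiableAt ℂ per x
  equation : ∀ x ∈ cutLambda θ t₁ t₂,
    (UMat t₁ t₂ - x • (1 : Matrix (Fin 2) (Fin 2) ℂ)).mulVec (deriv per x)
      = (muMat + ((l : ℂ) + 1 / 2) • (1 : Matrix (Fin 2) (Fin 2) ℂ)).mulVec (per x)
  normalised : ∃ h : ℂ → C2,
    (h =O[𝓝[cutLambda θ t₁ t₂] (canon θ t₁ t₂ i)] fun x => x - canon θ t₁ t₂ i) ∧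
    ∀ x ∈ cutLambda θ t₁ t₂,
      per x = ((-1 : ℂ) ^ l / (Real.sqrt (2 * Real.pi) : ℂ) * Gamma ((l : ℂ) + 1 / 2) *
          exp ((-(l : ℂ) - 1 / 2) * logBranch θ (x - canon θ t₁ t₂ i))) •
        ((PsiInv θ t₂).mulVec (Pi.single i 1) + h x)
  anti_invariant : ∃ (ρ : ℝ) (J : ℂ → C2), DifferentiableOn ℂ J {s | s.re < ρ} ∧
    (∀ s : ℂ, s.re < ρ → θ - 2 * Real.pi < s.im → s.im < θ →
      J s = per (canon θ t₁ t₂ i + exp s)) ∧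
    ∀ s : ℂ, s.re < ρ → J (s + 2 * Real.pi * I) = -J s

/-- The loop space element `𝔣_a = ∑_n I^{(n)}_a (-z)ⁿ`, with `I_a = a₁ I_{e_1} + a₂ I_{e_2}`:
`loopElement per a n` is its coefficient at `zⁿ`, a function of `λ`. -/
def loopElement (per : Fin 2 → ℤ → ℂ → C2) (a : C2) (n : ℤ) (x : ℂ) : C2 :=
  (-1 : ℂ) ^ n • ∑ i, a i • per i n x

/-! ### Formal differentiation and integration -/

/-- Formal expressions `∑ c_k λᵏ + ∑ d_p λᵖ log λ` (finite sums, `k ∈ ℤ`, `p ∈ ℕ`): the first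
component holds the `c_k`, the second the `d_p`. -/
abbrev LogLaurent : Type := (ℤ →₀ ℂ) × (ℕ →₀ ℂ)

/-- The constant `c`. -/
def LogLaurent.const (c : ℂ) : LogLaurent := (Finsupp.single 0 c, 0)

/-- The expression `log λ`. -/
def LogLaurent.logX : LogLaurent := (0, Finsupp.single 0 1)

/-- Formal differentiation in `λ`: `λᵏ ↦ k λᵏ⁻¹`, `λᵖ log λ ↦ λᵖ⁻¹ + p λᵖ⁻¹ log λ`. -/
def formalDeriv (f : LogLaurent) : LogLaurent :=
  f.1.sum (fun k c => (Finsupp.single (k - 1) (k * c), 0)) +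
  f.2.sum (fun p c => (Finsupp.single ((p : ℤ) - 1) c, Finsupp.single (p - 1) (p * c)))

/-- Formal integration in `λ` without integration constants: `λ⁻¹ ↦ log λ`,
`λᵏ ↦ λᵏ⁺¹ / (k + 1)` for `k ≠ -1`, and
`λᵖ log λ ↦ λᵖ⁺¹ / (p + 1) * (log λ - 1 / (p + 1))`. -/
def formalInt (f : LogLaurent) : LogLaurent :=
  f.1.sum (fun k c => if k = -1 then (0, Finsupp.single 0 c)
    else (Finsupp.single (k + 1) (c / ((k : ℂ) + 1)), 0)) +
  f.2.sum (fun p c => (Finsupp.single ((p : ℤ) + 1) (-(c / ((p : ℂ) + 1) ^ 2)),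
    Finsupp.single (p + 1) (c / ((p : ℂ) + 1))))

/-- The power `∂^l` of formal differentiation: for `l < 0` it is `-l` formal integrations. -/
def formalPow : ℤ → LogLaurent → LogLaurent
  | Int.ofNat m => formalDeriv^[m]
  | Int.negSucc m => formalInt^[m + 1]

/-- The function of `λ` given by a formal expression, with `log λ = logBranch θ λ`. -/
def LogLaurent.eval (θ : ℝ) (f : LogLaurent) (x : ℂ) : ℂ :=
  f.1.sum (fun k c => c * x ^ k) + f.2.sum (fun p c => c * (x ^ p * logBranch θ x))

/-! ### The series at infinity -/

/-- The vectors `I^{(l)}_{e_i,∞}`: for `i = 1` the components are `∂^{l+1} (log λ + ψ/2)` and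
`∂^l (1/2)`; for `i = 2` one adds `∂^{l+1} (π i)` to the first component. -/
def perInfty (θ : ℝ) (ψ : ℂ) : Fin 2 → ℤ → ℂ → C2 :=
  ![fun l x =>
      ![(formalPow (l + 1) (LogLaurent.logX + LogLaurent.const (ψ / 2))).eval θ x,
        (formalPow l (LogLaurent.const (1 / 2))).eval θ x],
    fun l x =>
      ![(formalPow (l + 1) (LogLaurent.logX + LogLaurent.const (ψ / 2))).eval θ x +
          (formalPow (l + 1) (LogLaurent.const (Real.pi * I))).eval θ x,
        (formalPow l (LogLaurent.const (1 / 2))).eval θ x]]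

/-- The closed sector `θ - 2π + δ ≤ arg λ ≤ θ - δ`, which stays away from the direction
`arg λ = θ`. -/
def sector (θ δ : ℝ) : Set ℂ :=
  {x | (logBranch θ x).im ∈ Set.Icc (θ - 2 * Real.pi + δ) (θ - δ)}

/-- The asymptotic relation `f(λ, z) ∼ S(z) g(λ, z)` for `|λ| → ∞`, `arg λ ≠ θ`, where
`S(z) = ∑_{k ≥ 0} S_k z⁻ᵏ` and `f n`, `g n` are the coefficients at `zⁿ`. The coefficient of
`S g` at `zⁿ` is the series `∑_k S_k g_{n+k}`; for every `n` and `K` its partial sum over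
`k < K` has to differ from `f n` by `O(|λ|^{-(n+K)})`, uniformly in every closed sector which
stays away from the direction `arg λ = θ`. -/
def AsymptoticAtInfinity (θ : ℝ) (f : ℤ → ℂ → C2) (S : ℕ → Matrix (Fin 2) (Fin 2) ℂ)
    (g : ℤ → ℂ → C2) : Prop :=
  ∀ δ : ℝ, 0 < δ → ∀ (n : ℤ) (K : ℕ),
    (fun x : ℂ => f n x - ∑ k ∈ Finset.range K, (S k).mulVec (g (n + k) x))
      =O[Bornology.cobounded ℂ ⊓ 𝓟 (sector θ δ)] fun x : ℂ => ‖x‖ ^ (-(n + (K : ℤ)))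

end Catalan

end

/-!
# Period vectors of a two-dimensional Frobenius manifold and their expansion at infinity

Write `y = λ - t₁`, `A = √(λ - u¹)`, `B = √(λ - u²)`, so that `(A B)² = y² - 4 t₂ = det (λ - U)`.

*Existence.* At level `-1` the period equation has the closed solution `perBase` with components
`2 log ((A + B) / (2 t₂^{1/4}))`, shifted by `π i` for `i = 2`, and `A B / 2`. All other levels are
reached by differentiating (`IsLevel.up`) or by applying `(μ + l + 1/2)⁻¹ (U - λ)`
(`IsLevel.down`). The normalisation and the sign change around `u^i` both follow from one local
normal form, `HasLocalForm`: near `u^i` the solution is its prescribed leading power of `λ - u^i`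
times a function that is analytic at `u^i`. At level `-1` this says that the logarithm is an odd
analytic function of `√(λ - u^i)` (`exists_log_root_add_root`), and the form passes to the
neighbouring levels.

*Uniqueness.* The Wronskian of two solutions of level `l` is a constant multiple of
`((λ - u¹)(λ - u²))^{-l-1/2}`. If both solutions change sign around `u^i`, their Wronskian does not,
while this power does; so the constant is zero (`IsPeriodVector.wronskian_eq_zero`) and the
solutions are proportional. The normalisation makes them equal (`IsPeriodVector.eq_period`).

*Asymptotics.* Let `E_K^n = I^{(n)} - ∑_{k < K} (-1)^k S_k I^{(n+k)}_∞`. The recursion of the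
calibration and the equation `(R - λ) I^{(l+1)}_∞ = (μ + l + 1/2) I^{(l)}_∞` give
`(U - λ) E_K^{n+1} = (μ + n + 1/2) E_K^n + O(|λ|^{-(n+K)})` (`remainder_equation`).
This relation can be solved for `E_K^{n+1}`, and for `E_K^n` if `n ≤ -2`, so the estimate at level
`-1` implies the one at every level by algebra alone (`isBigO_of_sourcedEquation`). At level `-1`
the equation turns into first order scalar equations whose right hand sides are small; they are
integrated along rays from infinity (`isBigO_of_hasDerivAt`), where the remainder vanishes thanks
to `(S_1)₁₂ = ψ + log t₂` (`tendsto_remainder`).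
-/

noncomputable section

namespace Catalan

/-! ### Branches of the logarithm -/

theorem exp_logBranch (θ : ℝ) {w : ℂ} (hw : w ≠ 0) : exp (logBranch θ w) = w := by
  rw [logBranch, exp_add, exp_log (mul_ne_zero hw (exp_ne_zero _)), mul_assoc, ← exp_add,
    neg_mul, neg_add_cancel, exp_zero, mul_one]

theorem logBranch_im_mem (θ : ℝ) (w : ℂ) :
    (logBranch θ w).im ∈ Set.Ioc (θ - 2 * Real.pi) θ := by
  have h1 := neg_pi_lt_log_im (w * exp (-((θ - Real.pi : ℝ) : ℂ) * I))
  have h2 := log_im_le_pi (w * exp (-((θ - Real.pi : ℝ) : ℂ) * I))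
  have h3 : (logBranch θ w).im
      = (log (w * exp (-((θ - Real.pi : ℝ) : ℂ) * I))).im + (θ - Real.pi) := by
    rw [logBranch, add_im, im_ofReal_mul, I_im, mul_one]
  rw [h3]
  constructor <;> linarith

theorem logBranch_exp {θ : ℝ} {s : ℂ} (h1 : θ - 2 * Real.pi < s.im) (h2 : s.im ≤ θ) :
    logBranch θ (exp s) = s := by
  have h3 : (s + -((θ - Real.pi : ℝ) : ℂ) * I).im = s.im - (θ - Real.pi) := by
    simp; ring
  rw [logBranch, ← exp_add, log_exp (by rw [h3]; linarith) (by rw [h3]; linarith)]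
  ring

theorem mem_cutPlane_iff {θ : ℝ} {w : ℂ} :
    w ∈ cutPlane θ ↔ w * exp (-((θ - Real.pi : ℝ) : ℂ) * I) ∈ slitPlane := by
  have hexp : exp (θ * I) * exp (-((θ - Real.pi : ℝ) : ℂ) * I) = -1 := by
    rw [← exp_add, ← exp_pi_mul_I]; congr 1; push_cast; ring
  rw [mem_slitPlane_iff_not_le_zero, cutPlane, Set.mem_ofPred_eq, not_iff_not]
  constructor
  · rintro ⟨r, hr, rfl⟩
    rw [mul_assoc, hexp, mul_neg_one, ← ofReal_neg, ← ofReal_zero, real_le_real]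
    linarith
  · intro h
    obtain ⟨hre, him⟩ := Complex.le_def.1 h
    set v := w * exp (-((θ - Real.pi : ℝ) : ℂ) * I) with hv
    refine ⟨-v.re, by simpa using hre, ?_⟩
    have h1 : v = v.re := by
      apply Complex.ext <;> simp_all
    have h2 : w = v * exp (((θ - Real.pi : ℝ) : ℂ) * I) := by
      rw [hv, mul_assoc, ← exp_add, neg_mul, neg_add_cancel, exp_zero, mul_one]
    have h3 : exp (((θ - Real.pi : ℝ) : ℂ) * I) = -exp (θ * I) := by
      rw [show ((θ - Real.pi : ℝ) : ℂ) * I = θ * I - Real.pi * I by push_cast; ring, exp_sub,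
        exp_pi_mul_I, div_neg, div_one]
    rw [h2, h3, ofReal_neg, ← h1]
    ring

theorem ne_zero_of_mem_cutPlane {θ : ℝ} {w : ℂ} (hw : w ∈ cutPlane θ) : w ≠ 0 := by
  rintro rfl
  exact hw ⟨0, le_rfl, by simp⟩

theorem exp_mem_cutPlane {θ : ℝ} {s : ℂ} (h1 : θ - 2 * Real.pi < s.im) (h2 : s.im < θ) :
    exp s ∈ cutPlane θ := by
  have h3 : (s + -((θ - Real.pi : ℝ) : ℂ) * I).im = s.im - (θ - Real.pi) := by
    simp; ring
  rw [mem_cutPlane_iff, ← exp_add, mem_slitPlane_iff_arg]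
  refine ⟨?_, exp_ne_zero _⟩
  rw [← log_im, log_exp (by rw [h3]; linarith) (by rw [h3]; linarith), h3]
  intro h
  linarith

theorem logBranch_im_lt {θ : ℝ} {w : ℂ} (hw : w ∈ cutPlane θ) : (logBranch θ w).im < θ := by
  refine lt_of_le_of_ne (logBranch_im_mem θ w).2 fun h => ?_
  refine hw ⟨Real.exp (logBranch θ w).re, (Real.exp_pos _).le, ?_⟩
  have h1 : logBranch θ w = ((logBranch θ w).re : ℂ) + θ * I := by
    conv_lhs => rw [← re_add_im (logBranch θ w), h]
  rw [ofReal_exp, ← exp_add, ← h1, exp_logBranch θ (ne_zero_of_mem_cutPlane hw)]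

theorem isOpen_cutPlane (θ : ℝ) : IsOpen (cutPlane θ) := by
  have : cutPlane θ = (fun w => w * exp (-((θ - Real.pi : ℝ) : ℂ) * I)) ⁻¹' slitPlane := by
    ext w; exact mem_cutPlane_iff
  rw [this]
  exact isOpen_slitPlane.preimage (by fun_prop)

theorem hasDerivAt_logBranch {θ : ℝ} {w : ℂ} (hw : w ∈ cutPlane θ) :
    HasDerivAt (logBranch θ) w⁻¹ w := by
  have h1 : HasDerivAt (fun w : ℂ => w * exp (-((θ - Real.pi : ℝ) : ℂ) * I))
      (exp (-((θ - Real.pi : ℝ) : ℂ) * I)) w := by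
    simpa using (hasDerivAt_id w).mul_const (exp (-((θ - Real.pi : ℝ) : ℂ) * I))
  have h2 := (h1.clog (mem_cutPlane_iff.1 hw)).add_const (((θ - Real.pi : ℝ) : ℂ) * I)
  exact h2.congr_deriv (div_mul_cancel_right₀ (exp_ne_zero _) w)

theorem logBranch_ofReal_mul (θ : ℝ) {r : ℝ} (hr : 0 < r) {w : ℂ} (hw : w ≠ 0) :
    logBranch θ (r * w) = Real.log r + logBranch θ w := by
  rw [logBranch, mul_assoc, log_ofReal_mul hr (mul_ne_zero hw (exp_ne_zero _)), logBranch]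
  ring

/-! ### The canonical coordinates and the cut `λ`-plane -/

theorem isOpen_cutLambda (θ : ℝ) (t₁ t₂ : ℂ) : IsOpen (cutLambda θ t₁ t₂) := by
  have : cutLambda θ t₁ t₂
      = ⋂ i, (fun x => x - canon θ t₁ t₂ i) ⁻¹' cutPlane θ := by
    ext x; simp [cutLambda]
  rw [this]
  exact isOpen_iInter_of_finite fun i => (isOpen_cutPlane θ).preimage (by fun_prop)

/-- A cut in the direction `exp (θ i)` is never met when moving in the opposite direction. -/
theorem sub_mem_cutPlane {θ : ℝ} {w : ℂ} (hw : w ∈ cutPlane θ) {r : ℝ} (hr : 0 ≤ r) :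
    w - r * exp (θ * I) ∈ cutPlane θ := by
  rintro ⟨p, hp, h⟩
  exact hw ⟨p + r, by positivity, by push_cast; linear_combination h⟩

theorem mem_cutPlane_of_re_neg {θ : ℝ} {w : ℂ} (hw : (w * exp (-(θ * I))).re < 0) :
    w ∈ cutPlane θ := by
  rintro ⟨p, hp, rfl⟩
  rw [mul_assoc, ← exp_add] at hw
  simp at hw
  linarith

/-- The half plane of all `x` whose component in the direction `exp (θ i)` is below `M`. -/
def backHalfPlane (θ M : ℝ) : Set ℂ := {x | (x * exp (-(θ * I))).re < M}

theorem convex_backHalfPlane (θ M : ℝ) : Convex ℝ (backHalfPlane θ M) := by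
  have h : IsLinearMap ℝ fun x : ℂ => (x * exp (-(θ * I))).re :=
    ⟨fun x y => by rw [add_mul, add_re], fun c x => by
      rw [real_smul, mul_assoc, re_ofReal_mul, smul_eq_mul]⟩
  exact convex_halfSpace_lt h M

theorem isPreconnected_cutLambda (θ : ℝ) (t₁ t₂ : ℂ) : IsPreconnected (cutLambda θ t₁ t₂) := by
  obtain ⟨M, hM⟩ : ∃ M : ℝ, ∀ i, M ≤ (canon θ t₁ t₂ i * exp (-(θ * I))).re := by
    refine ⟨min (canon θ t₁ t₂ 0 * exp (-(θ * I))).re (canon θ t₁ t₂ 1 * exp (-(θ * I))).re,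
      fun i => ?_⟩
    fin_cases i
    · exact min_le_left _ _
    · exact min_le_right _ _
  have hH : backHalfPlane θ M ⊆ cutLambda θ t₁ t₂ := by
    intro x hx i
    apply mem_cutPlane_of_re_neg
    rw [sub_mul, sub_re]
    have h1 : (x * exp (-(θ * I))).re < M := hx
    linarith [hM i]
  have hbase : ((M - 1 : ℝ) : ℂ) * exp (θ * I) ∈ backHalfPlane θ M := by
    rw [backHalfPlane, Set.mem_ofPred_eq, mul_assoc, ← exp_add]
    simp
  refine isPreconnected_of_forall (((M - 1 : ℝ) : ℂ) * exp (θ * I)) fun x hx => ?_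
  set ray : Set ℂ := (fun r : ℝ => x - r * exp (θ * I)) '' Set.Ici 0 with hray
  refine ⟨backHalfPlane θ M ∪ ray, ?_, Or.inl hbase, Or.inr ⟨0, by simp, by simp⟩, ?_⟩
  · apply Set.union_subset hH
    rintro _ ⟨r, hr, rfl⟩ i
    have := sub_mem_cutPlane (hx i) hr
    rwa [sub_right_comm] at this
  · set r := max 0 ((x * exp (-(θ * I))).re - M + 1) with hr
    refine IsPreconnected.union (x - r * exp (θ * I)) ?_ ⟨r, Set.mem_Ici.2 (le_max_left _ _), rfl⟩
      (convex_backHalfPlane θ M).isPreconnected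
      (isPreconnected_Ici.image _ (by fun_prop))
    rw [backHalfPlane, Set.mem_ofPred_eq, sub_mul, mul_assoc, ← exp_add]
    simp
    have := le_max_right 0 ((x * exp (-(θ * I))).re - M + 1)
    rw [← hr] at this
    simp at this
    linarith

theorem ne_zero_of_chart {θ : ℝ} {t₂ : ℂ} (ht : t₂ ∈ cutPlane (2 * θ)) : t₂ ≠ 0 :=
  ne_zero_of_mem_cutPlane ht

theorem powT_ne_zero (θ : ℝ) (t₂ s : ℂ) : powT θ t₂ s ≠ 0 := exp_ne_zero _

theorem powT_half (θ : ℝ) (t₂ : ℂ) : powT θ t₂ (1 / 2) = powT θ t₂ (1 / 4) ^ 2 := by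
  rw [powT, powT, ← exp_nat_mul]; congr 1; push_cast; ring

theorem powT_neg_quarter (θ : ℝ) (t₂ : ℂ) : powT θ t₂ (-(1 / 4)) = (powT θ t₂ (1 / 4))⁻¹ := by
  rw [powT, powT, ← exp_neg]; congr 1; ring

theorem powT_quarter_pow_four {θ : ℝ} {t₂ : ℂ} (ht : t₂ ∈ cutPlane (2 * θ)) :
    powT θ t₂ (1 / 4) ^ 4 = t₂ := by
  rw [powT, ← exp_nat_mul]
  conv_rhs => rw [← exp_logBranch (2 * θ) (ne_zero_of_chart ht), ← logT]
  congr 1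
  push_cast; ring

theorem logT_im_mem {θ : ℝ} {t₂ : ℂ} (ht : t₂ ∈ cutPlane (2 * θ)) :
    (logT θ t₂).im ∈ Set.Ioo (2 * θ - 2 * Real.pi) (2 * θ) :=
  ⟨(logBranch_im_mem (2 * θ) t₂).1, logBranch_im_lt ht⟩

theorem canon_zero_sub_one (θ : ℝ) (t₁ t₂ : ℂ) :
    canon θ t₁ t₂ 0 - canon θ t₁ t₂ 1 = exp (Real.log 4 + logT θ t₂ / 2) := by
  rw [exp_add, ← ofReal_exp, Real.exp_log (by norm_num)]
  simp only [canon, powT, Matrix.cons_val_zero, Matrix.cons_val_one]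
  rw [show logT θ t₂ / 2 = 1 / 2 * logT θ t₂ by ring]
  push_cast; ring

theorem canon_one_sub_zero (θ : ℝ) (t₁ t₂ : ℂ) :
    canon θ t₁ t₂ 1 - canon θ t₁ t₂ 0 = exp (Real.log 4 + logT θ t₂ / 2 - Real.pi * I) := by
  rw [exp_sub, exp_pi_mul_I, ← canon_zero_sub_one θ t₁ t₂]
  ring

theorem canon_zero_sub_one_log_im_mem {θ : ℝ} {t₂ : ℂ} (ht : t₂ ∈ cutPlane (2 * θ)) :
    (Real.log 4 + logT θ t₂ / 2 : ℂ).im ∈ Set.Ioo (θ - Real.pi) θ := by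
  obtain ⟨h1, h2⟩ := logT_im_mem ht
  have : (Real.log 4 + logT θ t₂ / 2 : ℂ).im = (logT θ t₂).im / 2 := by
    rw [add_im, ofReal_im, zero_add, show logT θ t₂ / 2 = ((1 / 2 : ℝ) : ℂ) * logT θ t₂ by
      push_cast; ring, im_ofReal_mul]
    ring
  rw [this]
  constructor <;> linarith

theorem canon_one_sub_zero_log_im_mem {θ : ℝ} {t₂ : ℂ} (ht : t₂ ∈ cutPlane (2 * θ)) :
    (Real.log 4 + logT θ t₂ / 2 - Real.pi * I : ℂ).im
      ∈ Set.Ioo (θ - 2 * Real.pi) (θ - Real.pi) := by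
  obtain ⟨h1, h2⟩ := canon_zero_sub_one_log_im_mem ht
  rw [sub_im, im_ofReal_mul, I_im, mul_one]
  constructor <;> linarith

/-- Neither canonical coordinate lies on the cut that starts at the other one. -/
theorem canon_sub_canon_mem {θ : ℝ} {t₁ t₂ : ℂ} (ht : t₂ ∈ cutPlane (2 * θ)) {i j : Fin 2}
    (hij : i ≠ j) : canon θ t₁ t₂ i - canon θ t₁ t₂ j ∈ cutPlane θ := by
  have h0 := canon_zero_sub_one_log_im_mem ht
  have h1 := canon_one_sub_zero_log_im_mem ht
  have hpi := Real.pi_pos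
  have hcases : (i = 0 ∧ j = 1) ∨ (i = 1 ∧ j = 0) := by
    fin_cases i <;> fin_cases j <;> simp_all
  rcases hcases with ⟨rfl, rfl⟩ | ⟨rfl, rfl⟩
  · rw [canon_zero_sub_one]
    exact exp_mem_cutPlane (by linarith [h0.1]) h0.2
  · rw [canon_one_sub_zero]
    exact exp_mem_cutPlane h1.1 (by linarith [h1.2])

/-- The discriminant `(λ - u¹)(λ - u²) = det (λ - U)`. -/
theorem canon_mul {θ : ℝ} {t₁ t₂ : ℂ} (ht : t₂ ∈ cutPlane (2 * θ)) (x : ℂ) :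
    (x - canon θ t₁ t₂ 0) * (x - canon θ t₁ t₂ 1) = (t₁ - x) ^ 2 - 4 * t₂ := by
  simp only [canon, Matrix.cons_val_zero, Matrix.cons_val_one, powT_half]
  linear_combination (-4) * powT_quarter_pow_four ht

theorem sub_canon_ne_zero {θ : ℝ} {t₁ t₂ x : ℂ} (hx : x ∈ cutLambda θ t₁ t₂) (i : Fin 2) :
    x - canon θ t₁ t₂ i ≠ 0 := ne_zero_of_mem_cutPlane (hx i)

theorem disc_ne_zero {θ : ℝ} {t₁ t₂ x : ℂ} (ht : t₂ ∈ cutPlane (2 * θ))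
    (hx : x ∈ cutLambda θ t₁ t₂) : (t₁ - x) ^ 2 - 4 * t₂ ≠ 0 := by
  rw [← canon_mul ht]
  exact mul_ne_zero (sub_canon_ne_zero hx 0) (sub_canon_ne_zero hx 1)

/-! ### Square roots of `λ - u^i` -/

/-- The branch of `√(λ - u^i)` belonging to `logBranch θ`. -/
def root (θ : ℝ) (t₁ t₂ : ℂ) (i : Fin 2) (x : ℂ) : ℂ :=
  exp (logBranch θ (x - canon θ t₁ t₂ i) / 2)

theorem root_ne_zero (θ : ℝ) (t₁ t₂ : ℂ) (i : Fin 2) (x : ℂ) : root θ t₁ t₂ i x ≠ 0 :=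
  exp_ne_zero _

theorem root_sq {θ : ℝ} {t₁ t₂ x : ℂ} {i : Fin 2} (hx : x - canon θ t₁ t₂ i ≠ 0) :
    root θ t₁ t₂ i x ^ 2 = x - canon θ t₁ t₂ i := by
  rw [root, ← exp_nat_mul]
  conv_rhs => rw [← exp_logBranch θ hx]
  congr 1; push_cast; ring

theorem hasDerivAt_root {θ : ℝ} {t₁ t₂ x : ℂ} {i : Fin 2}
    (hx : x - canon θ t₁ t₂ i ∈ cutPlane θ) :
    HasDerivAt (root θ t₁ t₂ i) (1 / (2 * root θ t₁ t₂ i x)) x := by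
  have h1 : HasDerivAt (fun x => logBranch θ (x - canon θ t₁ t₂ i) / 2)
      ((x - canon θ t₁ t₂ i)⁻¹ / 2) x :=
    ((hasDerivAt_logBranch hx).comp_sub_const x _).div_const 2
  refine h1.cexp.congr_deriv ?_
  have h2 := root_sq (ne_zero_of_mem_cutPlane hx)
  have h3 := root_ne_zero θ t₁ t₂ i x
  rw [← root, ← h2]
  field_simp

theorem root_mul_sq {θ : ℝ} {t₁ t₂ x : ℂ} (ht : t₂ ∈ cutPlane (2 * θ))
    (hx : x ∈ cutLambda θ t₁ t₂) :
    (root θ t₁ t₂ 0 x * root θ t₁ t₂ 1 x) ^ 2 = (t₁ - x) ^ 2 - 4 * t₂ := by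
  rw [mul_pow, root_sq (sub_canon_ne_zero hx 0), root_sq (sub_canon_ne_zero hx 1), canon_mul ht]

theorem root_one_canon_zero {θ : ℝ} {t₁ t₂ : ℂ} (ht : t₂ ∈ cutPlane (2 * θ)) :
    root θ t₁ t₂ 1 (canon θ t₁ t₂ 0) = 2 * powT θ t₂ (1 / 4) := by
  have h0 := canon_zero_sub_one_log_im_mem ht
  have hpi := Real.pi_pos
  rw [root, canon_zero_sub_one, logBranch_exp (by linarith [h0.1]) h0.2.le, add_div, exp_add,
    ← ofReal_ofNat, ← ofReal_div, ← ofReal_exp, powT,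
    show Real.log 4 = 2 * Real.log 2 by
      rw [show (4 : ℝ) = 2 ^ 2 by norm_num, Real.log_pow]; norm_num,
    mul_div_cancel_left₀ _ (by norm_num), Real.exp_log (by norm_num)]
  congr 2; push_cast; ring

theorem root_zero_canon_one {θ : ℝ} {t₁ t₂ : ℂ} (ht : t₂ ∈ cutPlane (2 * θ)) :
    root θ t₁ t₂ 0 (canon θ t₁ t₂ 1) = -(2 * I * powT θ t₂ (1 / 4)) := by
  have h1 := canon_one_sub_zero_log_im_mem ht
  have hpi := Real.pi_pos
  rw [root, canon_one_sub_zero, logBranch_exp h1.1 (by linarith [h1.2]), sub_div, exp_sub,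
    show (Real.pi * I : ℂ) / 2 = Real.pi / 2 * I by ring, exp_pi_div_two_mul_I, add_div, exp_add,
    ← ofReal_ofNat, ← ofReal_div, ← ofReal_exp, powT,
    show Real.log 4 = 2 * Real.log 2 by
      rw [show (4 : ℝ) = 2 ^ 2 by norm_num, Real.log_pow]; norm_num,
    mul_div_cancel_left₀ _ (by norm_num), Real.exp_log (by norm_num),
    show logT θ t₂ / ((2 : ℝ) : ℂ) / ((2 : ℝ) : ℂ) = 1 / 4 * logT θ t₂ by push_cast; ring,
    div_I]
  push_cast; ring

/-- All roots `√(λ - u^i)` lie in one open half plane, so their sum avoids the cut of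
`logBranch (θ / 2 + π / 2)`. -/
theorem root_re_pos {θ : ℝ} {t₁ t₂ x : ℂ} {i : Fin 2}
    (hx : x - canon θ t₁ t₂ i ∈ cutPlane θ) :
    0 < (root θ t₁ t₂ i x *
      exp (-((θ / 2 + Real.pi / 2 - Real.pi : ℝ) : ℂ) * I)).re := by
  have h1 := logBranch_im_mem θ (x - canon θ t₁ t₂ i)
  have h2 := logBranch_im_lt hx
  rw [root, ← exp_add, exp_re]
  refine mul_pos (Real.exp_pos _) (Real.cos_pos_of_mem_Ioo ?_)
  have : (logBranch θ (x - canon θ t₁ t₂ i) / 2 +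
      -((θ / 2 + Real.pi / 2 - Real.pi : ℝ) : ℂ) * I).im
      = (logBranch θ (x - canon θ t₁ t₂ i)).im / 2 - (θ / 2 - Real.pi / 2) := by
    rw [add_im, ← ofReal_neg, im_ofReal_mul, I_im,
      show ∀ z : ℂ, z / 2 = ((1 / 2 : ℝ) : ℂ) * z from fun z => by push_cast; ring, im_ofReal_mul]
    ring
  rw [this]
  constructor <;> linarith [h1.1]

theorem root_mem_cutPlane {θ : ℝ} {t₁ t₂ x : ℂ} {i : Fin 2}
    (hx : x - canon θ t₁ t₂ i ∈ cutPlane θ) :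
    root θ t₁ t₂ i x ∈ cutPlane (θ / 2 + Real.pi / 2) := by
  rw [mem_cutPlane_iff, mem_slitPlane_iff]
  exact Or.inl (root_re_pos hx)

theorem root_add_root_mem_cutPlane {θ : ℝ} {t₁ t₂ x : ℂ} (hx : x ∈ cutLambda θ t₁ t₂) :
    root θ t₁ t₂ 0 x + root θ t₁ t₂ 1 x ∈ cutPlane (θ / 2 + Real.pi / 2) := by
  rw [mem_cutPlane_iff, mem_slitPlane_iff, add_mul, add_re]
  exact Or.inl (add_pos (root_re_pos (hx 0)) (root_re_pos (hx 1)))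

/-! ### Towers of solutions -/

/-- `p` solves the period equation of level `l` on the cut plane and `p'` is its derivative.
The equation is written in components. -/
structure IsLevel (θ : ℝ) (t₁ t₂ : ℂ) (l : ℤ) (p p' : ℂ → C2) : Prop where
  hasDerivAt : ∀ x ∈ cutLambda θ t₁ t₂, HasDerivAt p (p' x) x
  fst : ∀ x ∈ cutLambda θ t₁ t₂, (t₁ - x) * p' x 0 + 2 * p' x 1 = (l + 1) * p x 0
  snd : ∀ x ∈ cutLambda θ t₁ t₂, 2 * t₂ * p' x 0 + (t₁ - x) * p' x 1 = l * p x 1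

theorem IsLevel.apply {θ : ℝ} {t₁ t₂ : ℂ} {l : ℤ} {p p' : ℂ → C2} (h : IsLevel θ t₁ t₂ l p p')
    {x : ℂ} (hx : x ∈ cutLambda θ t₁ t₂) (a : Fin 2) :
    HasDerivAt (fun x => p x a) (p' x a) x :=
  hasDerivAt_pi.1 (h.hasDerivAt x hx) a

theorem IsLevel.up {θ : ℝ} {t₁ t₂ : ℂ} {l : ℤ} {p p' : ℂ → C2}
    (h : IsLevel θ t₁ t₂ l p p') : IsLevel θ t₁ t₂ (l + 1) p' (deriv p') := by
  have hopen := isOpen_cutLambda θ t₁ t₂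
  have hd : DifferentiableOn ℂ p (cutLambda θ t₁ t₂) := fun x hx =>
    (h.hasDerivAt x hx).differentiableAt.differentiableWithinAt
  have hd' : ∀ x ∈ cutLambda θ t₁ t₂, HasDerivAt p' (deriv p' x) x := by
    intro x hx
    have h1 : DifferentiableAt ℂ (deriv p) x :=
      ((hd.analyticOnNhd hopen).deriv x hx).differentiableAt
    have h2 : deriv p =ᶠ[𝓝 x] p' := by
      filter_upwards [hopen.mem_nhds hx] with y hy using (h.hasDerivAt y hy).deriv
    exact (h2.differentiableAt_iff.1 h1).hasDerivAt
  have hc : ∀ x ∈ cutLambda θ t₁ t₂, ∀ a, HasDerivAt (fun x => p' x a) (deriv p' x a) x :=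
    fun x hx a => hasDerivAt_pi.1 (hd' x hx) a
  refine ⟨hd', fun x hx => ?_, fun x hx => ?_⟩
  · have h1 := (((hasDerivAt_id x).const_sub t₁).mul (hc x hx 0)).add
      ((hc x hx 1).const_mul 2)
    have h2 : HasDerivAt _ _ x := (h.apply hx 0).const_mul ((l : ℂ) + 1)
    have h3 := h1.unique (h2.congr_of_eventuallyEq (by
      filter_upwards [hopen.mem_nhds hx] with y hy using h.fst y hy))
    simp only [id] at h3
    push_cast
    linear_combination h3
  · have h1 := ((hc x hx 0).const_mul (2 * t₂)).add
      (((hasDerivAt_id x).const_sub t₁).mul (hc x hx 1))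
    have h2 : HasDerivAt _ _ x := (h.apply hx 1).const_mul (l : ℂ)
    have h3 := h1.unique (h2.congr_of_eventuallyEq (by
      filter_upwards [hopen.mem_nhds hx] with y hy using h.snd y hy))
    simp only [id] at h3
    push_cast
    linear_combination h3

/-- The solution of level `l` whose derivative is `p`, for `l ≠ 0, -1`: it is
`(μ + l + 1/2)⁻¹ (U - λ) p`. -/
def lower (t₁ t₂ : ℂ) (l : ℤ) (p : ℂ → C2) (x : ℂ) : C2 :=
  ![((t₁ - x) * p x 0 + 2 * p x 1) / (l + 1), (2 * t₂ * p x 0 + (t₁ - x) * p x 1) / l]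

theorem IsLevel.down {θ : ℝ} {t₁ t₂ : ℂ} {l : ℤ} {p p' : ℂ → C2}
    (h : IsLevel θ t₁ t₂ (l + 1) p p') (h0 : (l : ℂ) ≠ 0) (h1 : (l : ℂ) + 1 ≠ 0) :
    IsLevel θ t₁ t₂ l (lower t₁ t₂ l p) p := by
  refine ⟨fun x hx => ?_, fun x hx => ?_, fun x hx => ?_⟩
  · rw [hasDerivAt_pi]
    have e1 := h.fst x hx
    have e2 := h.snd x hx
    push_cast at e1 e2
    intro a
    fin_cases a
    · refine (((((hasDerivAt_id x).const_sub t₁).mul (h.apply hx 0)).add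
        ((h.apply hx 1).const_mul 2)).div_const ((l : ℂ) + 1)).congr_deriv ?_
      simp only [id, Fin.zero_eta]
      rw [div_eq_iff h1]
      linear_combination e1
    · refine ((((h.apply hx 0).const_mul (2 * t₂)).add
        (((hasDerivAt_id x).const_sub t₁).mul (h.apply hx 1))).div_const (l : ℂ)).congr_deriv ?_
      simp only [id, Fin.mk_one]
      rw [div_eq_iff h0]
      linear_combination e2
  · exact (mul_div_cancel₀ _ h1).symm
  · exact (mul_div_cancel₀ _ h0).symm

/-! ### Explicit period vectors -/

/-- The period vector of level `-1` in closed form. With `A = √(λ - u¹)` and `B = √(λ - u²)` its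
components are `2 log ((A + B) / (2 t₂^{1/4}))`, shifted by `π i` for `i = 2`, and `A B / 2`. -/
def perBase (θ : ℝ) (t₁ t₂ : ℂ) (i : Fin 2) (x : ℂ) : C2 :=
  ![2 * logBranch (θ / 2 + Real.pi / 2) (root θ t₁ t₂ 0 x + root θ t₁ t₂ 1 x)
      - 2 * Real.log 2 - logT θ t₂ / 2 + ![0, Real.pi * I] i,
    root θ t₁ t₂ 0 x * root θ t₁ t₂ 1 x / 2]

theorem hasDerivAt_perBase {θ : ℝ} {t₁ t₂ x : ℂ} (i : Fin 2)
    (hx : x ∈ cutLambda θ t₁ t₂) :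
    HasDerivAt (perBase θ t₁ t₂ i) ![1 / (root θ t₁ t₂ 0 x * root θ t₁ t₂ 1 x),
      (x - t₁) / (2 * (root θ t₁ t₂ 0 x * root θ t₁ t₂ 1 x))] x := by
  have hA := hasDerivAt_root (hx 0)
  have hB := hasDerivAt_root (hx 1)
  have hA0 := root_ne_zero θ t₁ t₂ 0 x
  have hB0 := root_ne_zero θ t₁ t₂ 1 x
  have hAB := root_add_root_mem_cutPlane hx
  have hAB0 := ne_zero_of_mem_cutPlane hAB
  rw [hasDerivAt_pi]
  intro a
  fin_cases a
  · have h : HasDerivAt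
        (fun x => logBranch (θ / 2 + Real.pi / 2) (root θ t₁ t₂ 0 x + root θ t₁ t₂ 1 x)) _ x :=
      HasDerivAt.comp (h₂ := logBranch (θ / 2 + Real.pi / 2))
        (h := fun x => root θ t₁ t₂ 0 x + root θ t₁ t₂ 1 x) x (hasDerivAt_logBranch hAB)
        (hA.add hB)
    refine ((((h.const_mul 2).sub_const (2 * Real.log 2 : ℂ)).sub_const
      (logT θ t₂ / 2)).add_const (![0, Real.pi * I] i)).congr_deriv ?_
    simp only [Fin.zero_eta, Matrix.cons_val_zero]
    field_simp
    ring
  · refine ((hA.mul hB).div_const 2).congr_deriv ?_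
    simp only [Fin.mk_one, Matrix.cons_val_one, Matrix.cons_val_fin_one]
    have h1 := root_sq (sub_canon_ne_zero hx 0)
    have h2 := root_sq (sub_canon_ne_zero hx 1)
    have h3 : canon θ t₁ t₂ 0 + canon θ t₁ t₂ 1 = 2 * t₁ := by
      simp only [canon, Matrix.cons_val_zero, Matrix.cons_val_one]; ring
    field_simp
    linear_combination h1 + h2 - h3

theorem isLevel_perBase {θ : ℝ} {t₁ t₂ : ℂ} (ht : t₂ ∈ cutPlane (2 * θ)) (i : Fin 2) :
    IsLevel θ t₁ t₂ (-1) (perBase θ t₁ t₂ i) (deriv (perBase θ t₁ t₂ i)) := by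
  refine ⟨fun x hx => ?_, fun x hx => ?_, fun x hx => ?_⟩
  · have h := hasDerivAt_perBase i hx
    rwa [h.deriv]
  all_goals
    have h := (hasDerivAt_perBase i hx).deriv
    have hA0 := root_ne_zero θ t₁ t₂ 0 x
    have hB0 := root_ne_zero θ t₁ t₂ 1 x
    have hsq := root_mul_sq ht hx
    simp only [h, perBase, Matrix.cons_val_zero, Matrix.cons_val_one]
    push_cast
    field_simp
  · ring
  · linear_combination hsq

/-- The period vectors of level `n - 1`: iterated derivatives of the one of level `-1`. -/
def perUp (θ : ℝ) (t₁ t₂ : ℂ) (i : Fin 2) (n : ℕ) : ℂ → C2 := deriv^[n] (perBase θ t₁ t₂ i)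

/-- The period vectors of level `-1 - n`: iterated primitives of the one of level `-1`. -/
def perDown (θ : ℝ) (t₁ t₂ : ℂ) (i : Fin 2) : ℕ → ℂ → C2
  | 0 => perBase θ t₁ t₂ i
  | n + 1 => lower t₁ t₂ (Int.negSucc (n + 1)) (perDown θ t₁ t₂ i n)

/-- The period vectors `I^{(l)}_{e_i}`. -/
def period (θ : ℝ) (t₁ t₂ : ℂ) (i : Fin 2) : ℤ → ℂ → C2
  | Int.ofNat n => perUp θ t₁ t₂ i (n + 1)
  | Int.negSucc n => perDown θ t₁ t₂ i n

theorem period_neg_one (θ : ℝ) (t₁ t₂ : ℂ) (i : Fin 2) :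
    period θ t₁ t₂ i (-1) = perBase θ t₁ t₂ i := rfl

theorem isLevel_period {θ : ℝ} {t₁ t₂ : ℂ} (ht : t₂ ∈ cutPlane (2 * θ)) (i : Fin 2) (l : ℤ) :
    IsLevel θ t₁ t₂ l (period θ t₁ t₂ i l) (period θ t₁ t₂ i (l + 1)) := by
  have hbase := isLevel_perBase (t₁ := t₁) ht i
  match l with
  | Int.ofNat n =>
    have key : ∀ n : ℕ, IsLevel θ t₁ t₂ ((n : ℤ) - 1) (perUp θ t₁ t₂ i n)
        (perUp θ t₁ t₂ i (n + 1)) := by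
      intro n
      induction n with
      | zero => simpa [perUp] using hbase
      | succ n ih =>
        have := ih.up
        rw [show perUp θ t₁ t₂ i (n + 1 + 1) = deriv (perUp θ t₁ t₂ i (n + 1)) from
          Function.iterate_succ_apply' deriv (n + 1) _]
        rwa [show (n : ℤ) - 1 + 1 = ((n + 1 : ℕ) : ℤ) - 1 by push_cast; ring] at this
    have := key (n + 1)
    push_cast at this
    rw [add_sub_cancel_right] at this
    exact this
  | Int.negSucc 0 => exact hbase
  | Int.negSucc (n + 1) =>
    have key : ∀ n : ℕ, ∃ q, IsLevel θ t₁ t₂ (Int.negSucc n) (perDown θ t₁ t₂ i n) q := by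
      intro n
      induction n with
      | zero => exact ⟨_, hbase⟩
      | succ n ih =>
        obtain ⟨q, hq⟩ := ih
        refine ⟨_, IsLevel.down (p' := q) hq ?_ ?_⟩
        · exact_mod_cast Int.negSucc_ne_zero (n + 1)
        · have : Int.negSucc (n + 1) + 1 ≠ 0 := Int.negSucc_ne_zero n
          exact_mod_cast this
    obtain ⟨q, hq⟩ := key n
    refine IsLevel.down (p' := q) hq ?_ ?_
    · exact_mod_cast Int.negSucc_ne_zero (n + 1)
    · have : Int.negSucc (n + 1) + 1 ≠ 0 := Int.negSucc_ne_zero n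
      exact_mod_cast this

/-! ### Local normal forms at the canonical coordinates -/

/-- The leading term `(-1)^l / √(2π) Γ(l + 1/2) (λ - u^i)^{-l-1/2}` of the period vectors. -/
def prefactor (θ : ℝ) (t₁ t₂ : ℂ) (i : Fin 2) (l : ℤ) (x : ℂ) : ℂ :=
  (-1 : ℂ) ^ l / (Real.sqrt (2 * Real.pi) : ℂ) * Gamma ((l : ℂ) + 1 / 2) *
    exp ((-(l : ℂ) - 1 / 2) * logBranch θ (x - canon θ t₁ t₂ i))

theorem intCast_add_half_ne (l m : ℤ) : (l : ℂ) + 1 / 2 ≠ m := by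
  intro h
  have : ((2 * l + 1 : ℤ) : ℂ) = ((2 * m : ℤ) : ℂ) := by
    push_cast; linear_combination 2 * h
  have := Int.cast_injective this
  omega

theorem intCast_add_half_ne_zero (l : ℤ) : (l : ℂ) + 1 / 2 ≠ 0 := by
  simpa using intCast_add_half_ne l 0

theorem prefactor_coeff_ne_zero (l : ℤ) :
    (-1 : ℂ) ^ l / (Real.sqrt (2 * Real.pi) : ℂ) * Gamma ((l : ℂ) + 1 / 2) ≠ 0 := by
  refine mul_ne_zero (div_ne_zero (zpow_ne_zero _ (by norm_num)) ?_) (Gamma_ne_zero fun m => ?_)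
  · exact_mod_cast (Real.sqrt_pos.2 (by positivity)).ne'
  · exact_mod_cast intCast_add_half_ne l (-m)

theorem prefactor_ne_zero (θ : ℝ) (t₁ t₂ : ℂ) (i : Fin 2) (l : ℤ) (x : ℂ) :
    prefactor θ t₁ t₂ i l x ≠ 0 :=
  mul_ne_zero (prefactor_coeff_ne_zero l) (exp_ne_zero _)

theorem prefactor_succ {θ : ℝ} {t₁ t₂ : ℂ} {i : Fin 2} (l : ℤ) {x : ℂ}
    (hx : x - canon θ t₁ t₂ i ≠ 0) :
    (x - canon θ t₁ t₂ i) * prefactor θ t₁ t₂ i (l + 1) x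
      = -((l : ℂ) + 1 / 2) * prefactor θ t₁ t₂ i l x := by
  have h1 : Gamma (((l + 1 : ℤ) : ℂ) + 1 / 2) = ((l : ℂ) + 1 / 2) * Gamma ((l : ℂ) + 1 / 2) := by
    rw [← Gamma_add_one _ (intCast_add_half_ne_zero l)]
    congr 1; push_cast; ring
  have h2 : exp ((-(l : ℂ) - 1 / 2) * logBranch θ (x - canon θ t₁ t₂ i))
      = (x - canon θ t₁ t₂ i) *
        exp ((-((l + 1 : ℤ) : ℂ) - 1 / 2) * logBranch θ (x - canon θ t₁ t₂ i)) := by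
    conv_rhs => enter [1]; rw [← exp_logBranch θ hx]
    rw [← exp_add]
    congr 1; push_cast; ring
  rw [prefactor, prefactor, h1, h2, zpow_add_one₀ (by norm_num)]
  ring

theorem hasDerivAt_prefactor {θ : ℝ} {t₁ t₂ : ℂ} {i : Fin 2} (l : ℤ) {x : ℂ}
    (hx : x - canon θ t₁ t₂ i ∈ cutPlane θ) :
    HasDerivAt (prefactor θ t₁ t₂ i l) (prefactor θ t₁ t₂ i (l + 1) x) x := by
  have h0 := ne_zero_of_mem_cutPlane hx
  have h1 : HasDerivAt (fun x => (-(l : ℂ) - 1 / 2) * logBranch θ (x - canon θ t₁ t₂ i))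
      ((-(l : ℂ) - 1 / 2) * (x - canon θ t₁ t₂ i)⁻¹) x :=
    ((hasDerivAt_logBranch hx).comp_sub_const x _).const_mul _
  refine (h1.cexp.const_mul _).congr_deriv ?_
  have h2 := prefactor_succ l h0
  apply mul_left_cancel₀ h0
  rw [h2, prefactor]
  field_simp
  ring

/-- `f` is `prefactor l` times a function that is analytic at `u^i` and takes the value `c`
there. This encodes both the normalisation and the monodromy around `u^i`. -/
def HasLocalForm (θ : ℝ) (t₁ t₂ : ℂ) (i : Fin 2) (l : ℤ) (c : ℂ) (f : ℂ → ℂ) : Prop :=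
  ∃ H : ℂ → ℂ, AnalyticAt ℂ H (canon θ t₁ t₂ i) ∧ H (canon θ t₁ t₂ i) = c ∧
    ∀ᶠ x in 𝓝[cutLambda θ t₁ t₂] (canon θ t₁ t₂ i), f x = prefactor θ t₁ t₂ i l x * H x

/-- The point `u^i - r exp (θ i)` is opposite to the cut that starts at `u^i`. -/
theorem canon_sub_mem_cutLambda {θ : ℝ} {t₁ t₂ : ℂ} (ht : t₂ ∈ cutPlane (2 * θ)) (i : Fin 2)
    {r : ℝ} (hr : 0 < r) : canon θ t₁ t₂ i - r * exp (θ * I) ∈ cutLambda θ t₁ t₂ := by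
  intro j
  by_cases hij : i = j
  · subst hij
    apply mem_cutPlane_of_re_neg
    rw [sub_sub_cancel_left, neg_mul, mul_assoc, ← exp_add]
    simpa using hr
  · rw [sub_right_comm]
    exact sub_mem_cutPlane (canon_sub_canon_mem ht hij) hr.le

theorem canon_mem_closure {θ : ℝ} {t₁ t₂ : ℂ} (ht : t₂ ∈ cutPlane (2 * θ)) (i : Fin 2) :
    canon θ t₁ t₂ i ∈ closure (cutLambda θ t₁ t₂) := by
  have h : Tendsto (fun r : ℝ => canon θ t₁ t₂ i - r * exp (θ * I)) (𝓝[>] 0)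
      (𝓝 (canon θ t₁ t₂ i)) := by
    have h1 : Continuous fun r : ℝ => canon θ t₁ t₂ i - r * exp (θ * I) := by fun_prop
    have h2 := h1.tendsto 0
    simp only [ofReal_zero, zero_mul, sub_zero] at h2
    exact h2.mono_left nhdsWithin_le_nhds
  exact mem_closure_of_tendsto h (eventually_mem_nhdsWithin.mono fun r hr =>
    canon_sub_mem_cutLambda ht i hr)

/-- Differentiating the normal form of level `l` gives one of level `l + 1` whose analytic factor
has the same value at `u^i`. -/
theorem hasLocalForm_deriv_aux {θ : ℝ} {t₁ t₂ : ℂ} {i : Fin 2} {l : ℤ} {f f' H : ℂ → ℂ}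
    (hH : AnalyticAt ℂ H (canon θ t₁ t₂ i))
    (hf : ∀ x ∈ cutLambda θ t₁ t₂, HasDerivAt f (f' x) x)
    (hfH : ∀ᶠ x in 𝓝[cutLambda θ t₁ t₂] (canon θ t₁ t₂ i),
      f x = prefactor θ t₁ t₂ i l x * H x) :
    ∀ᶠ x in 𝓝[cutLambda θ t₁ t₂] (canon θ t₁ t₂ i), f' x = prefactor θ t₁ t₂ i (l + 1) x *
      (H x - (x - canon θ t₁ t₂ i) * deriv H x / ((l : ℂ) + 1 / 2)) := by
  have hl := intCast_add_half_ne_zero l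
  filter_upwards [eventually_eventually_nhdsWithin.2 hfH, eventually_mem_nhdsWithin,
    nhdsWithin_le_nhds hH.eventually_analyticAt] with x hx1 hx2 hx3
  rw [(isOpen_cutLambda θ t₁ t₂).nhdsWithin_eq hx2] at hx1
  have h1 := ((hasDerivAt_prefactor l (hx2 i)).mul
    hx3.differentiableAt.hasDerivAt).congr_of_eventuallyEq hx1
  rw [(hf x hx2).unique h1]
  have h2 : (x - canon θ t₁ t₂ i) * prefactor θ t₁ t₂ i (l + 1) x / ((l : ℂ) + 1 / 2)
      = -prefactor θ t₁ t₂ i l x := by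
    rw [prefactor_succ l (sub_canon_ne_zero hx2 i), neg_mul, neg_div, mul_div_cancel_left₀ _ hl]
  linear_combination deriv H x * h2

theorem HasLocalForm.up {θ : ℝ} {t₁ t₂ : ℂ} {i : Fin 2} {l : ℤ} {c : ℂ} {f f' : ℂ → ℂ}
    (h : HasLocalForm θ t₁ t₂ i l c f)
    (hf : ∀ x ∈ cutLambda θ t₁ t₂, HasDerivAt f (f' x) x) :
    HasLocalForm θ t₁ t₂ i (l + 1) c f' := by
  obtain ⟨H, hH, hc, hfH⟩ := h
  refine ⟨_, ?_, ?_, hasLocalForm_deriv_aux hH hf hfH⟩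
  · have := hH.deriv
    fun_prop
  · simp [hc]

/-- If a primitive `g` of `f` is `prefactor (l + 1)` times an analytic function vanishing at
`u^i`, then it has the normal form of level `l` with the same leading coefficient as `f`. -/
theorem HasLocalForm.down {θ : ℝ} {t₁ t₂ : ℂ} (ht : t₂ ∈ cutPlane (2 * θ)) {i : Fin 2} {l : ℤ}
    {c : ℂ} {f g Q : ℂ → ℂ} (h : HasLocalForm θ t₁ t₂ i (l + 1) c f)
    (hg : ∀ x ∈ cutLambda θ t₁ t₂, HasDerivAt g (f x) x)
    (hQ : AnalyticAt ℂ Q (canon θ t₁ t₂ i)) (hQ0 : Q (canon θ t₁ t₂ i) = 0)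
    (hgQ : ∀ᶠ x in 𝓝[cutLambda θ t₁ t₂] (canon θ t₁ t₂ i),
      g x = prefactor θ t₁ t₂ i (l + 1) x * Q x) :
    HasLocalForm θ t₁ t₂ i l c g := by
  obtain ⟨H, hH, hc, hfH⟩ := h
  have hG : AnalyticAt ℂ (dslope Q (canon θ t₁ t₂ i)) (canon θ t₁ t₂ i) := by
    obtain ⟨p, hp⟩ := hQ
    exact ⟨_, hp.has_fpower_series_dslope_fslope⟩
  set K : ℂ → ℂ := fun x => -((l : ℂ) + 1 / 2) * dslope Q (canon θ t₁ t₂ i) x with hK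
  have hKa : AnalyticAt ℂ K (canon θ t₁ t₂ i) := by fun_prop
  have hgK : ∀ᶠ x in 𝓝[cutLambda θ t₁ t₂] (canon θ t₁ t₂ i),
      g x = prefactor θ t₁ t₂ i l x * K x := by
    filter_upwards [hgQ, eventually_mem_nhdsWithin] with x hx1 hx2
    have h1 := prefactor_succ l (sub_canon_ne_zero hx2 i)
    have h2 : (x - canon θ t₁ t₂ i) * dslope Q (canon θ t₁ t₂ i) x = Q x := by
      simpa [hQ0] using sub_smul_dslope Q (canon θ t₁ t₂ i) x
    rw [hx1, ← h2, hK]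
    linear_combination dslope Q (canon θ t₁ t₂ i) x * h1
  refine ⟨K, hKa, ?_, hgK⟩
  -- The leading coefficients are compared by differentiating the normal form of `g`.
  have hne : (𝓝[cutLambda θ t₁ t₂] (canon θ t₁ t₂ i)).NeBot :=
    mem_closure_iff_nhdsWithin_neBot.1 (canon_mem_closure ht i)
  set L : ℂ → ℂ := fun x => K x - (x - canon θ t₁ t₂ i) * deriv K x / ((l : ℂ) + 1 / 2) with hL
  have hLa : AnalyticAt ℂ L (canon θ t₁ t₂ i) := by
    have := hKa.deriv
    fun_prop
  have h1 : ∀ᶠ x in 𝓝[cutLambda θ t₁ t₂] (canon θ t₁ t₂ i), H x = L x := by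
    filter_upwards [hfH, hasLocalForm_deriv_aux hKa hg hgK] with x hx1 hx2
    exact mul_left_cancel₀ (prefactor_ne_zero θ t₁ t₂ i (l + 1) x) (hx1.symm.trans hx2)
  have h2 : H (canon θ t₁ t₂ i) = L (canon θ t₁ t₂ i) :=
    tendsto_nhds_unique_of_eventuallyEq (hH.continuousAt.mono_left nhdsWithin_le_nhds)
      (hLa.continuousAt.mono_left nhdsWithin_le_nhds) h1
  rw [← hc, h2, hL]
  simp

/-! ### The normal form of level `-1` -/

/-- An even analytic function is an analytic function of the square of its argument. -/
theorem exists_analyticAt_comp_sq {φ : ℂ → ℂ} (hφ : AnalyticAt ℂ φ 0)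
    (heven : ∀ᶠ z in 𝓝 0, φ (-z) = φ z) :
    ∃ g : ℂ → ℂ, AnalyticAt ℂ g 0 ∧ ∀ᶠ z in 𝓝 0, φ z = g (z ^ 2) := by
  obtain ⟨r, hr, hball⟩ := Metric.eventually_nhds_iff_ball.1 (heven.and hφ.eventually_analyticAt)
  have hsq : ∀ z : ℂ, (z ^ (1 / 2 : ℂ)) ^ 2 = z := fun z => by simp
  have hball' : ∀ z ∈ Metric.ball (0 : ℂ) (r ^ 2), ∀ w : ℂ, w ^ 2 = z → w ∈ Metric.ball 0 r := by
    intro z hz w hw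
    rw [mem_ball_zero_iff] at hz ⊢
    rw [← hw, norm_pow] at hz
    exact lt_of_pow_lt_pow_left₀ 2 hr.le hz
  -- Evenness makes the value independent of the choice of the square root.
  have hindep : ∀ z ∈ Metric.ball (0 : ℂ) (r ^ 2), ∀ w : ℂ, w ^ 2 = z →
      φ (z ^ (1 / 2 : ℂ)) = φ w := by
    intro z hz w hw
    rcases sq_eq_sq_iff_eq_or_eq_neg.1 ((hsq z).trans hw.symm) with h | h
    · rw [h]
    · rw [h]; exact (hball w (hball' z hz w hw)).1
  have hcpow : ∀ z ∈ slitPlane, DifferentiableAt ℂ (fun z : ℂ => z ^ (1 / 2 : ℂ)) z :=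
    fun z hz => differentiableAt_id.cpow (differentiableAt_const _) hz
  have hr2 : (0 : ℝ) < r ^ 2 := by positivity
  refine ⟨fun z => φ (z ^ (1 / 2 : ℂ)), ?_, ?_⟩
  · apply analyticAt_of_differentiable_on_punctured_nhds_of_continuousAt
    · filter_upwards [nhdsWithin_le_nhds (Metric.ball_mem_nhds (0 : ℂ) hr2),
        self_mem_nhdsWithin] with z hz hz0
      by_cases hslit : z ∈ slitPlane
      · exact (hball _ (hball' z hz _ (hsq z))).2.differentiableAt.comp z (hcpow z hslit)
      · have hneg : -z ∈ slitPlane := by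
          have hz0' : z ≠ 0 := hz0
          rw [mem_slitPlane_iff] at hslit ⊢
          push Not at hslit
          refine Or.inl ?_
          rw [neg_re]
          rcases hslit.1.lt_or_eq with h | h
          · linarith
          · exact absurd (Complex.ext h hslit.2) hz0'
        have hroot : ∀ z : ℂ, (I * (-z) ^ (1 / 2 : ℂ)) ^ 2 = z := fun z => by
          rw [mul_pow, hsq, I_sq]; ring
        have h1 : DifferentiableAt ℂ (fun z : ℂ => φ (I * (-z) ^ (1 / 2 : ℂ))) z := by
          refine DifferentiableAt.comp z
            (hball _ (hball' z hz _ (hroot z))).2.differentiableAt ?_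
          exact ((hcpow (-z) hneg).comp z differentiableAt_id.neg).const_mul I
        refine h1.congr_of_eventuallyEq ?_
        filter_upwards [Metric.isOpen_ball.mem_nhds hz] with y hy
        exact hindep y hy _ (hroot y)
    · have h0 : (0 : ℂ) ^ (1 / 2 : ℂ) = 0 := by simp
      refine ContinuousAt.comp (g := φ) ?_ (continuousAt_cpow_const_of_re_pos (by simp) (by simp))
      rw [h0]
      exact hφ.continuousAt
  · filter_upwards [Metric.ball_mem_nhds (0 : ℂ) hr] with z hz
    refine (hindep (z ^ 2) ?_ z rfl).symm
    rw [mem_ball_zero_iff] at hz ⊢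
    rw [norm_pow]
    exact pow_lt_pow_left₀ hz (norm_nonneg _) two_ne_zero

/-- An odd analytic function is `z` times an analytic function of `z ^ 2`. -/
theorem exists_analyticAt_mul_comp_sq {f : ℂ → ℂ} (hf : AnalyticAt ℂ f 0)
    (hodd : ∀ᶠ z in 𝓝 0, f (-z) = -f z) :
    ∃ g : ℂ → ℂ, AnalyticAt ℂ g 0 ∧ g 0 = deriv f 0 ∧ ∀ᶠ z in 𝓝 0, f z = z * g (z ^ 2) := by
  have hf0 : f 0 = 0 := by
    have h := hodd.self_of_nhds
    rw [neg_zero] at h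
    exact self_eq_neg.1 h
  have hd : ∀ z, z * dslope f 0 z = f z := fun z => by simpa [hf0] using sub_smul_dslope f 0 z
  have ha : AnalyticAt ℂ (dslope f 0) 0 := by
    obtain ⟨p, hp⟩ := hf
    exact ⟨_, hp.has_fpower_series_dslope_fslope⟩
  obtain ⟨g, hg, hfg⟩ := exists_analyticAt_comp_sq ha (by
    filter_upwards [hodd] with z hz
    rcases eq_or_ne z 0 with rfl | hz0
    · simp
    · apply mul_left_cancel₀ hz0
      linear_combination (-1 : ℂ) * hd (-z) - hd z - hz)
  refine ⟨g, hg, ?_, ?_⟩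
  · have := hfg.self_of_nhds
    rw [dslope_same] at this
    simpa using this.symm
  · filter_upwards [hfg] with z hz
    rw [← hz, hd]

theorem analyticAt_logBranch {θ : ℝ} {w : ℂ} (hw : w ∈ cutPlane θ) :
    AnalyticAt ℂ (logBranch θ) w :=
  DifferentiableOn.analyticAt
    (fun _ hz => (hasDerivAt_logBranch hz).differentiableAt.differentiableWithinAt)
    ((isOpen_cutPlane θ).mem_nhds hw)

theorem analyticAt_root {θ : ℝ} {t₁ t₂ x : ℂ} {i : Fin 2}
    (hx : x - canon θ t₁ t₂ i ∈ cutPlane θ) : AnalyticAt ℂ (root θ t₁ t₂ i) x := by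
  have h := (analyticAt_logBranch hx).comp_of_eq (f := fun x => x - canon θ t₁ t₂ i)
    (by fun_prop) rfl
  have h2 : AnalyticAt ℂ (fun x => logBranch θ (x - canon θ t₁ t₂ i) / 2) x := h.div_const
  exact h2.cexp

theorem tendsto_root {θ : ℝ} {t₁ t₂ : ℂ} (i : Fin 2) :
    Tendsto (root θ t₁ t₂ i) (𝓝[cutLambda θ t₁ t₂] (canon θ t₁ t₂ i)) (𝓝 0) := by
  have h1 : Tendsto (fun x => Real.sqrt ‖x - canon θ t₁ t₂ i‖)
      (𝓝[cutLambda θ t₁ t₂] (canon θ t₁ t₂ i)) (𝓝 0) := by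
    have h2 : Continuous fun x => Real.sqrt ‖x - canon θ t₁ t₂ i‖ := by fun_prop
    have h3 := h2.tendsto (canon θ t₁ t₂ i)
    rw [sub_self, norm_zero, Real.sqrt_zero] at h3
    exact h3.mono_left nhdsWithin_le_nhds
  refine squeeze_zero_norm' ?_ h1
  filter_upwards [eventually_mem_nhdsWithin] with x hx
  rw [← root_sq (sub_canon_ne_zero hx i), norm_pow, Real.sqrt_sq (norm_nonneg _)]

/-- Near `u^i` the logarithm in `perBase` is an odd analytic function of `σ = √(λ - u^i)`: its
`σ`-derivative is `2 / √(σ² + u^i - u^j)`. -/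
theorem exists_log_root_add_root {θ : ℝ} {t₁ t₂ : ℂ} (ht : t₂ ∈ cutPlane (2 * θ)) {i j : Fin 2}
    (hij : i ≠ j) {κ : ℂ}
    (hκ : 2 * logBranch (θ / 2 + Real.pi / 2) (root θ t₁ t₂ j (canon θ t₁ t₂ i)) + κ = 0) :
    ∃ g : ℂ → ℂ, AnalyticAt ℂ g 0 ∧ g 0 = 2 / root θ t₁ t₂ j (canon θ t₁ t₂ i) ∧
      ∀ᶠ x in 𝓝[cutLambda θ t₁ t₂] (canon θ t₁ t₂ i),
        2 * logBranch (θ / 2 + Real.pi / 2) (root θ t₁ t₂ i x + root θ t₁ t₂ j x) + κ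
          = root θ t₁ t₂ i x * g (x - canon θ t₁ t₂ i) := by
  set u := canon θ t₁ t₂ i with hu
  have huj : u - canon θ t₁ t₂ j ∈ cutPlane θ := canon_sub_canon_mem ht hij
  set C : ℂ → ℂ := fun σ => root θ t₁ t₂ j (u + σ ^ 2) with hC
  have hsq : Continuous fun σ : ℂ => u + σ ^ 2 := by fun_prop
  have hC1 : ∀ᶠ σ in 𝓝 (0 : ℂ), u + σ ^ 2 - canon θ t₁ t₂ j ∈ cutPlane θ := by
    have h1 : Continuous fun σ : ℂ => u + σ ^ 2 - canon θ t₁ t₂ j := by fun_prop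
    exact h1.continuousAt.eventually_mem ((isOpen_cutPlane θ).mem_nhds (by simpa using huj))
  have hCa : AnalyticAt ℂ C 0 := by
    refine (analyticAt_root (x := u + 0 ^ 2) (by simpa using huj)).comp_of_eq
      (f := fun σ => u + σ ^ 2) (by fun_prop) rfl
  have hC2 : ∀ᶠ σ in 𝓝 (0 : ℂ), σ + C σ ∈ cutPlane (θ / 2 + Real.pi / 2) := by
    have h1 : ContinuousAt (fun σ => σ + C σ) 0 := continuousAt_id.add hCa.continuousAt
    refine h1.eventually_mem ((isOpen_cutPlane _).mem_nhds ?_)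
    simpa [hC] using root_mem_cutPlane huj
  set f : ℂ → ℂ := fun σ => 2 * logBranch (θ / 2 + Real.pi / 2) (σ + C σ) + κ with hf
  have hfd : ∀ᶠ σ in 𝓝 (0 : ℂ), HasDerivAt f (2 / C σ) σ := by
    filter_upwards [hC1, hC2] with σ h1 h2
    have hC0 : C σ ≠ 0 := root_ne_zero _ _ _ _ _
    have h0 := ne_zero_of_mem_cutPlane h2
    have h3 : HasDerivAt (fun σ : ℂ => u + σ ^ 2) (2 * σ) σ := by
      simpa using (hasDerivAt_pow 2 σ).const_add u
    have h4 : HasDerivAt C (1 / (2 * C σ) * (2 * σ)) σ :=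
      HasDerivAt.comp (h₂ := root θ t₁ t₂ j) (h := fun σ : ℂ => u + σ ^ 2) σ (hasDerivAt_root h1) h3
    have h5 : HasDerivAt (fun σ => logBranch (θ / 2 + Real.pi / 2) (σ + C σ)) _ σ :=
      HasDerivAt.comp (h₂ := logBranch (θ / 2 + Real.pi / 2)) (h := fun σ => σ + C σ) σ
        (hasDerivAt_logBranch h2) ((hasDerivAt_id σ).add h4)
    refine ((h5.const_mul 2).add_const κ).congr_deriv ?_
    field_simp
    ring
  obtain ⟨r, hr, hball⟩ := Metric.eventually_nhds_iff_ball.1 hfd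
  have hf0 : f 0 = 0 := by simpa [hf, hC] using hκ
  have hfa : AnalyticAt ℂ f 0 := DifferentiableOn.analyticAt
    (fun σ hσ => (hball σ hσ).differentiableAt.differentiableWithinAt) (Metric.ball_mem_nhds 0 hr)
  have hodd : ∀ᶠ σ in 𝓝 (0 : ℂ), f (-σ) = -f σ := by
    have hd : ∀ σ ∈ Metric.ball (0 : ℂ) r, HasDerivAt (fun σ => f (-σ) + f σ) 0 σ := by
      intro σ hσ
      have hσ' : -σ ∈ Metric.ball (0 : ℂ) r := by simpa using hσ
      have h1 := (hball (-σ) hσ').comp σ (hasDerivAt_neg σ)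
      refine (h1.add (hball σ hσ)).congr_deriv ?_
      simp [hC]
    filter_upwards [Metric.ball_mem_nhds (0 : ℂ) hr] with σ hσ
    have h1 := Metric.isOpen_ball.is_const_of_deriv_eq_zero
      (convex_ball (0 : ℂ) r).isPreconnected
      (fun σ hσ => (hd σ hσ).differentiableAt.differentiableWithinAt)
      (fun σ hσ => (hd σ hσ).deriv) hσ (Metric.mem_ball_self hr)
    simp only [neg_zero, hf0, add_zero] at h1
    exact eq_neg_of_add_eq_zero_left h1
  obtain ⟨g, hg, hg0, hfg⟩ := exists_analyticAt_mul_comp_sq hfa hodd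
  refine ⟨g, hg, ?_, ?_⟩
  · rw [hg0, hfd.self_of_nhds.deriv]
    simp [hC]
  · filter_upwards [(tendsto_root i).eventually hfg, eventually_mem_nhdsWithin] with x hx1 hx2
    have h1 : root θ t₁ t₂ i x ^ 2 = x - u := root_sq (sub_canon_ne_zero hx2 i)
    rw [h1] at hx1
    rw [← hx1]
    simp only [hf, hC]
    rw [h1, add_sub_cancel]

theorem prefactor_neg_one (θ : ℝ) (t₁ t₂ : ℂ) (i : Fin 2) (x : ℂ) :
    prefactor θ t₁ t₂ i (-1) x = (Real.sqrt 2 : ℂ) * root θ t₁ t₂ i x := by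
  have h1 : Gamma (((-1 : ℤ) : ℂ) + 1 / 2) = -2 * (Real.sqrt Real.pi : ℂ) := by
    have h2 := Gamma_add_one (((-1 : ℤ) : ℂ) + 1 / 2) (intCast_add_half_ne_zero (-1))
    have h3 : ((-1 : ℤ) : ℂ) + 1 / 2 + 1 = ((1 / 2 : ℝ) : ℂ) := by push_cast; ring
    rw [h3, Gamma_ofReal, Real.Gamma_one_half_eq] at h2
    push_cast at h2 ⊢
    linear_combination 2 * h2
  have h2 : (Real.sqrt Real.pi : ℂ) ≠ 0 := by
    exact_mod_cast (Real.sqrt_pos.2 Real.pi_pos).ne'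
  have h3 : (Real.sqrt 2 : ℂ) ^ 2 = 2 := by
    rw [← ofReal_pow, Real.sq_sqrt (by norm_num)]; norm_num
  have h4 : (Real.sqrt 2 : ℂ) ≠ 0 := by
    intro h; rw [h] at h3; norm_num at h3
  rw [prefactor, h1, Real.sqrt_mul (by norm_num), ofReal_mul, root]
  have h5 : (-((-1 : ℤ) : ℂ) - 1 / 2) * logBranch θ (x - canon θ t₁ t₂ i)
      = logBranch θ (x - canon θ t₁ t₂ i) / 2 := by push_cast; ring
  rw [h5, zpow_neg_one]
  field_simp
  linear_combination (-1) * h3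

/-- The column `Ψ⁻¹ e_i` in terms of the value of the other root at `u^i`. -/
theorem psiInv_mulVec {θ : ℝ} {t₁ t₂ : ℂ} (ht : t₂ ∈ cutPlane (2 * θ)) {i j : Fin 2}
    (hij : i ≠ j) :
    (PsiInv θ t₂).mulVec (Pi.single i 1)
      = ![2 / root θ t₁ t₂ j (canon θ t₁ t₂ i) / (Real.sqrt 2 : ℂ),
          root θ t₁ t₂ j (canon θ t₁ t₂ i) / 2 / (Real.sqrt 2 : ℂ)] := by
  have hq : powT θ t₂ (1 / 4) ≠ 0 := powT_ne_zero _ _ _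
  have hcases : (i = 0 ∧ j = 1) ∨ (i = 1 ∧ j = 0) := by
    fin_cases i <;> fin_cases j <;> simp_all
  have h4 : (Real.sqrt 2 : ℂ) ≠ 0 := by
    exact_mod_cast (Real.sqrt_pos.2 (by norm_num : (0 : ℝ) < 2)).ne'
  rw [Matrix.mulVec_single_one, PsiInv, powT_neg_quarter]
  rcases hcases with ⟨rfl, rfl⟩ | ⟨rfl, rfl⟩
  · rw [root_one_canon_zero ht]
    generalize powT θ t₂ (1 / 4) = q at hq
    ext a
    fin_cases a <;> simp [Matrix.col] <;> field_simp
  · rw [root_zero_canon_one ht]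
    generalize powT θ t₂ (1 / 4) = q at hq
    ext a
    fin_cases a <;> simp [Matrix.col] <;> field_simp
    simp

theorem hasLocalForm_perBase {θ : ℝ} {t₁ t₂ : ℂ} (ht : t₂ ∈ cutPlane (2 * θ)) (i a : Fin 2) :
    HasLocalForm θ t₁ t₂ i (-1) ((PsiInv θ t₂).mulVec (Pi.single i 1) a)
      (fun x => perBase θ t₁ t₂ i x a) := by
  have h4 : (Real.sqrt 2 : ℂ) ≠ 0 := by
    exact_mod_cast (Real.sqrt_pos.2 (by norm_num : (0 : ℝ) < 2)).ne'
  have hfst : ∀ j : Fin 2, i ≠ j → ∀ κ : ℂ,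
      2 * logBranch (θ / 2 + Real.pi / 2) (root θ t₁ t₂ j (canon θ t₁ t₂ i)) + κ = 0 →
      (∀ x, perBase θ t₁ t₂ i x 0 = 2 * logBranch (θ / 2 + Real.pi / 2)
        (root θ t₁ t₂ i x + root θ t₁ t₂ j x) + κ) →
      HasLocalForm θ t₁ t₂ i (-1) ((PsiInv θ t₂).mulVec (Pi.single i 1) 0)
        (fun x => perBase θ t₁ t₂ i x 0) := by
    intro j hij κ hκ hper
    obtain ⟨g, hg, hg0, hgx⟩ := exists_log_root_add_root (t₁ := t₁) ht hij hκ
    refine ⟨fun x => g (x - canon θ t₁ t₂ i) / (Real.sqrt 2 : ℂ), ?_, ?_, ?_⟩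
    · exact (hg.comp_of_eq (f := fun x => x - canon θ t₁ t₂ i) (by fun_prop) (by simp)).div_const
    · simp only [sub_self, hg0]
      rw [psiInv_mulVec (t₁ := t₁) ht hij, Matrix.cons_val_zero]
    · filter_upwards [hgx] with x hx
      rw [hper, hx, prefactor_neg_one]
      field_simp
  have hsnd : ∀ j : Fin 2, i ≠ j →
      (∀ x, perBase θ t₁ t₂ i x 1 = root θ t₁ t₂ i x * root θ t₁ t₂ j x / 2) →
      HasLocalForm θ t₁ t₂ i (-1) ((PsiInv θ t₂).mulVec (Pi.single i 1) 1)
        (fun x => perBase θ t₁ t₂ i x 1) := by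
    intro j hij hper
    refine ⟨fun x => root θ t₁ t₂ j x / 2 / (Real.sqrt 2 : ℂ), ?_, ?_, ?_⟩
    · exact (analyticAt_root (canon_sub_canon_mem ht hij)).div_const.div_const
    · rw [psiInv_mulVec (t₁ := t₁) ht hij, Matrix.cons_val_one, Matrix.cons_val_fin_one]
    · refine Eventually.of_forall fun x => ?_
      simp only [hper, prefactor_neg_one]
      field_simp
  -- The value of the logarithm at `u^i`.
  have hval : ∀ z w : ℂ, z = exp w → w.im ∈ Set.Ioo (θ / 2 - Real.pi) (θ / 2) →
      logBranch (θ / 2 + Real.pi / 2) z = w := by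
    rintro z w rfl ⟨h1, h2⟩
    have := Real.pi_pos
    exact logBranch_exp (by linarith) (by linarith)
  have him := logT_im_mem ht
  have him4 : (Real.log 2 + 1 / 4 * logT θ t₂ : ℂ).im = (logT θ t₂).im / 4 := by
    rw [add_im, ofReal_im, zero_add, show (1 / 4 : ℂ) = ((1 / 4 : ℝ) : ℂ) by push_cast; ring,
      im_ofReal_mul]
    ring
  have hpi := Real.pi_pos
  have hlog2 : (2 : ℂ) = exp (Real.log 2) := by
    rw [← ofReal_exp, Real.exp_log (by norm_num)]; norm_num
  fin_cases i <;> fin_cases a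
  · refine hfst 1 (by decide) (-(2 * Real.log 2) - logT θ t₂ / 2) ?_ fun x => ?_
    · simp only [Fin.zero_eta]
      rw [hval _ (Real.log 2 + 1 / 4 * logT θ t₂) ?_ ?_]
      · ring
      · rw [root_one_canon_zero ht, exp_add, ← hlog2, powT]
      · rw [him4]
        constructor <;> linarith [him.1, him.2]
    · simp only [perBase, Fin.zero_eta, Matrix.cons_val_zero]
      ring
  · exact hsnd 1 (by decide) fun x => rfl
  · refine hfst 0 (by decide) (-(2 * Real.log 2) - logT θ t₂ / 2 + Real.pi * I) ?_ fun x => ?_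
    · simp only [Fin.mk_one]
      rw [hval _ (Real.log 2 + 1 / 4 * logT θ t₂ - Real.pi / 2 * I) ?_ ?_]
      · ring
      · rw [root_zero_canon_one ht, exp_sub, exp_add, ← hlog2, powT, exp_pi_div_two_mul_I, div_I]
        ring
      · rw [sub_im, him4, show (Real.pi / 2 * I : ℂ) = ((Real.pi / 2 : ℝ) : ℂ) * I by
          push_cast; ring, im_ofReal_mul, I_im]
        constructor <;> linarith [him.1, him.2]
    · simp only [perBase, Fin.mk_one, Matrix.cons_val_zero, Matrix.cons_val_one,
        Matrix.cons_val_fin_one]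
      rw [add_comm (root θ t₁ t₂ 1 x)]
      ring
  · exact hsnd 0 (by decide) fun x => by
      simp only [perBase, Fin.mk_one, Matrix.cons_val_one, Matrix.cons_val_fin_one]
      ring

/-- The leading vector `Ψ⁻¹ e_i` is an eigenvector of `U` with eigenvalue `u^i`. -/
theorem psiInv_eigenvector {θ : ℝ} {t₁ t₂ : ℂ} (ht : t₂ ∈ cutPlane (2 * θ)) (i : Fin 2) :
    (t₁ - canon θ t₁ t₂ i) * (PsiInv θ t₂).mulVec (Pi.single i 1) 0
        + 2 * (PsiInv θ t₂).mulVec (Pi.single i 1) 1 = 0 ∧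
      2 * t₂ * (PsiInv θ t₂).mulVec (Pi.single i 1) 0
        + (t₁ - canon θ t₁ t₂ i) * (PsiInv θ t₂).mulVec (Pi.single i 1) 1 = 0 := by
  obtain ⟨j, hij⟩ : ∃ j : Fin 2, i ≠ j := exists_ne i |>.imp fun _ h => h.symm
  have h4 : (Real.sqrt 2 : ℂ) ≠ 0 := by
    exact_mod_cast (Real.sqrt_pos.2 (by norm_num : (0 : ℝ) < 2)).ne'
  have h1 : root θ t₁ t₂ j (canon θ t₁ t₂ i) ^ 2 = canon θ t₁ t₂ i - canon θ t₁ t₂ j :=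
    root_sq (ne_zero_of_mem_cutPlane (canon_sub_canon_mem ht hij))
  have h2 : canon θ t₁ t₂ i + canon θ t₁ t₂ j = 2 * t₁ ∧
      (t₁ - canon θ t₁ t₂ i) ^ 2 = 4 * t₂ := by
    have h := powT_quarter_pow_four ht
    fin_cases i <;> fin_cases j <;>
      simp_all only [canon, powT_half, Fin.zero_eta, Fin.mk_one, Matrix.cons_val_zero,
        Matrix.cons_val_one, Matrix.cons_val_fin_one, ne_eq, not_true_eq_false]
    · exact ⟨by ring, by linear_combination 4 * h⟩
    · exact ⟨by ring, by linear_combination 4 * h⟩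
  have hc := root_ne_zero θ t₁ t₂ j (canon θ t₁ t₂ i)
  rw [psiInv_mulVec (t₁ := t₁) ht hij]
  simp only [Matrix.cons_val_zero, Matrix.cons_val_one, Matrix.cons_val_fin_one]
  generalize root θ t₁ t₂ j (canon θ t₁ t₂ i) = c at *
  constructor
  · field_simp
    linear_combination h1 - h2.1
  · field_simp
    linear_combination (-2) * h2.2 + (t₁ - canon θ t₁ t₂ i) * (h1 - h2.1)

theorem hasLocalForm_period {θ : ℝ} {t₁ t₂ : ℂ} (ht : t₂ ∈ cutPlane (2 * θ)) (i : Fin 2)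
    (l : ℤ) (a : Fin 2) :
    HasLocalForm θ t₁ t₂ i l ((PsiInv θ t₂).mulVec (Pi.single i 1) a)
      (fun x => period θ t₁ t₂ i l x a) := by
  have hup : ∀ l : ℤ, HasLocalForm θ t₁ t₂ i l ((PsiInv θ t₂).mulVec (Pi.single i 1) a)
      (fun x => period θ t₁ t₂ i l x a) →
      HasLocalForm θ t₁ t₂ i (l + 1) ((PsiInv θ t₂).mulVec (Pi.single i 1) a)
      (fun x => period θ t₁ t₂ i (l + 1) x a) := fun l h =>
    h.up fun x hx => (isLevel_period ht i l).apply hx a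
  match l with
  | Int.ofNat n =>
    induction n with
    | zero => exact hup (-1) (hasLocalForm_perBase ht i a)
    | succ n ih => exact hup _ ih
  | Int.negSucc n =>
    induction n generalizing a with
    | zero => exact hasLocalForm_perBase ht i a
    | succ n ih =>
      have ih' : ∀ a, HasLocalForm θ t₁ t₂ i (Int.negSucc (n + 1) + 1)
          ((PsiInv θ t₂).mulVec (Pi.single i 1) a)
          (fun x => period θ t₁ t₂ i (Int.negSucc (n + 1) + 1) x a) := fun a =>
        ih a fun l h => h.up fun x hx => (isLevel_period ht i l).apply hx a
      obtain ⟨H₀, hH₀, hc₀, hf₀⟩ := ih' 0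
      obtain ⟨H₁, hH₁, hc₁, hf₁⟩ := ih' 1
      obtain ⟨he₀, he₁⟩ := psiInv_eigenvector (t₁ := t₁) ht i
      have hder : ∀ a, ∀ x ∈ cutLambda θ t₁ t₂,
          HasDerivAt (fun x => period θ t₁ t₂ i (Int.negSucc (n + 1)) x a)
            (period θ t₁ t₂ i (Int.negSucc (n + 1) + 1) x a) x := fun a x hx =>
        (isLevel_period ht i _).apply hx a
      fin_cases a
      · refine (ih' 0).down ht (hder 0)
          (Q := fun x => ((t₁ - x) * H₀ x + 2 * H₁ x) / ((Int.negSucc (n + 1) : ℂ) + 1)) ?_ ?_ ?_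
        · exact AnalyticAt.div_const (by fun_prop)
        · simp only [hc₀, hc₁, he₀, zero_div]
        · filter_upwards [hf₀, hf₁] with x hx₀ hx₁
          have h : period θ t₁ t₂ i (Int.negSucc (n + 1)) x 0 = ((t₁ - x) *
              period θ t₁ t₂ i (Int.negSucc (n + 1) + 1) x 0
              + 2 * period θ t₁ t₂ i (Int.negSucc (n + 1) + 1) x 1) /
              ((Int.negSucc (n + 1) : ℂ) + 1) := rfl
          rw [hx₀, hx₁] at h
          refine h.trans ?_
          ring
      · refine (ih' 1).down ht (hder 1)
          (Q := fun x => (2 * t₂ * H₀ x + (t₁ - x) * H₁ x) / (Int.negSucc (n + 1) : ℂ)) ?_ ?_ ?_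
        · exact AnalyticAt.div_const (by fun_prop)
        · simp only [hc₀, hc₁, he₁, zero_div]
        · filter_upwards [hf₀, hf₁] with x hx₀ hx₁
          have h : period θ t₁ t₂ i (Int.negSucc (n + 1)) x 1 = (2 * t₂ *
              period θ t₁ t₂ i (Int.negSucc (n + 1) + 1) x 0
              + (t₁ - x) * period θ t₁ t₂ i (Int.negSucc (n + 1) + 1) x 1) /
              (Int.negSucc (n + 1) : ℂ) := rfl
          rw [hx₀, hx₁] at h
          refine h.trans ?_
          ring

/-! ### Existence of the period vectors -/

/-- A small punctured disc around `u^i`, described by the logarithm `s` of `λ - u^i`, lies in the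
cut plane as long as `s` stays in the strip of the chosen branch. -/
theorem exists_strip {θ : ℝ} {t₁ t₂ : ℂ} (ht : t₂ ∈ cutPlane (2 * θ)) (i : Fin 2)
    {p q : ℂ → Prop} (hp : ∀ᶠ x in 𝓝[cutLambda θ t₁ t₂] (canon θ t₁ t₂ i), p x)
    (hq : ∀ᶠ x in 𝓝 (canon θ t₁ t₂ i), q x) :
    ∃ ρ : ℝ, ∀ s : ℂ, s.re < ρ → q (canon θ t₁ t₂ i + exp s) ∧
      (θ - 2 * Real.pi < s.im → s.im < θ → canon θ t₁ t₂ i + exp s ∈ cutLambda θ t₁ t₂ ∧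
        logBranch θ (canon θ t₁ t₂ i + exp s - canon θ t₁ t₂ i) = s ∧
        p (canon θ t₁ t₂ i + exp s)) := by
  have hother : ∀ᶠ x in 𝓝 (canon θ t₁ t₂ i), ∀ j, i ≠ j → x - canon θ t₁ t₂ j ∈ cutPlane θ := by
    rw [eventually_all]
    intro j
    by_cases hij : i = j
    · exact Eventually.of_forall fun x h => absurd hij h
    · have h1 : Continuous fun x : ℂ => x - canon θ t₁ t₂ j := by fun_prop
      filter_upwards [h1.continuousAt.eventually_mem
        ((isOpen_cutPlane θ).mem_nhds (canon_sub_canon_mem ht hij))] with x hx _ using hx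
  obtain ⟨ε, hε, hball⟩ := Metric.eventually_nhds_iff_ball.1
    ((eventually_nhdsWithin_iff.1 hp).and (hq.and hother))
  refine ⟨Real.log ε, fun s hs => ?_⟩
  have hmem : canon θ t₁ t₂ i + exp s ∈ Metric.ball (canon θ t₁ t₂ i) ε := by
    rw [mem_ball_iff_norm, add_sub_cancel_left, norm_exp]
    exact (Real.lt_log_iff_exp_lt hε).1 hs
  obtain ⟨h1, h2, h3⟩ := hball _ hmem
  refine ⟨h2, fun him1 him2 => ?_⟩
  have hcut : canon θ t₁ t₂ i + exp s ∈ cutLambda θ t₁ t₂ := by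
    intro j
    by_cases hij : i = j
    · subst hij
      rw [add_sub_cancel_left]
      exact exp_mem_cutPlane him1 him2
    · exact h3 j hij
  refine ⟨hcut, ?_, h1 hcut⟩
  rw [add_sub_cancel_left, logBranch_exp him1 him2.le]

theorem isPeriodVector_period {θ : ℝ} {t₁ t₂ : ℂ} (ht : t₂ ∈ cutPlane (2 * θ)) (i : Fin 2)
    (l : ℤ) : IsPeriodVector θ t₁ t₂ i l (period θ t₁ t₂ i l) := by
  have hlev := isLevel_period (t₁ := t₁) ht i l
  choose H hH hHv hfH using hasLocalForm_period (t₁ := t₁) ht i l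
  refine ⟨fun x hx => (hlev.hasDerivAt x hx).differentiableAt, fun x hx => ?_, ?_, ?_⟩
  · rw [(hlev.hasDerivAt x hx).deriv]
    have h1 := hlev.fst x hx
    have h2 := hlev.snd x hx
    ext a
    fin_cases a
    · simp [Matrix.mulVec, dotProduct, Fin.sum_univ_two, UMat, muMat]
      linear_combination h1
    · simp [Matrix.mulVec, dotProduct, Fin.sum_univ_two, UMat, muMat]
      linear_combination h2
  · refine ⟨fun x => (prefactor θ t₁ t₂ i l x)⁻¹ • period θ t₁ t₂ i l x
      - (PsiInv θ t₂).mulVec (Pi.single i 1), ?_, fun x hx => ?_⟩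
    · rw [isBigO_pi]
      intro a
      have h1 := (hH a).differentiableAt.isBigO_sub.mono
        (nhdsWithin_le_nhds (s := cutLambda θ t₁ t₂))
      refine h1.congr' ?_ EventuallyEq.rfl
      filter_upwards [hfH a] with x hx
      rw [Pi.sub_apply, Pi.smul_apply, hx, smul_eq_mul,
        inv_mul_cancel_left₀ (prefactor_ne_zero _ _ _ _ _ _), hHv]
    · rw [add_sub_cancel, ← prefactor, smul_inv_smul₀ (prefactor_ne_zero _ _ _ _ _ _)]
  · obtain ⟨ρ, hρ⟩ := exists_strip (t₁ := t₁) ht i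
      ((hfH 0).and (hfH 1)) ((hH 0).eventually_analyticAt.and (hH 1).eventually_analyticAt)
    have hHa : ∀ a, ∀ s : ℂ, s.re < ρ → AnalyticAt ℂ (H a) (canon θ t₁ t₂ i + exp s) := by
      intro a s hs
      fin_cases a
      exacts [(hρ s hs).1.1, (hρ s hs).1.2]
    refine ⟨ρ, fun s a => (-1 : ℂ) ^ l / (Real.sqrt (2 * Real.pi) : ℂ) * Gamma ((l : ℂ) + 1 / 2) *
      exp ((-(l : ℂ) - 1 / 2) * s) * H a (canon θ t₁ t₂ i + exp s), ?_, ?_, ?_⟩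
    · rw [differentiableOn_pi]
      intro a s hs
      have h1 : DifferentiableAt ℂ (fun s => H a (canon θ t₁ t₂ i + exp s)) s :=
        DifferentiableAt.comp s (hHa a s hs).differentiableAt (by fun_prop)
      exact (DifferentiableAt.mul (by fun_prop) h1).differentiableWithinAt
    · intro s hs him1 him2
      obtain ⟨-, hlog, h0, h1⟩ := (hρ s hs).2 him1 him2
      ext a
      fin_cases a
      · refine (h0.trans ?_).symm
        rw [prefactor, hlog]
        rfl
      · refine (h1.trans ?_).symm
        rw [prefactor, hlog]
        rfl
    · intro s hs
      ext a
      have h1 : exp ((-(l : ℂ) - 1 / 2) * (s + 2 * Real.pi * I))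
          = -exp ((-(l : ℂ) - 1 / 2) * s) := by
        rw [show (-(l : ℂ) - 1 / 2) * (s + 2 * Real.pi * I)
          = (-(l : ℂ) - 1 / 2) * s + ((-l : ℤ) : ℂ) * (2 * Real.pi * I) - Real.pi * I by
            push_cast; ring, exp_sub, exp_add, exp_int_mul_two_pi_mul_I, exp_pi_mul_I]
        ring
      simp only [Pi.neg_apply]
      rw [h1, exp_add, exp_two_pi_mul_I, mul_one]
      ring

/-! ### Uniqueness of the period vectors -/

theorem IsPeriodVector.isLevel {θ : ℝ} {t₁ t₂ : ℂ} {i : Fin 2} {l : ℤ} {per : ℂ → C2}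
    (h : IsPeriodVector θ t₁ t₂ i l per) : IsLevel θ t₁ t₂ l per (deriv per) := by
  refine ⟨fun x hx => (h.differentiableAt x hx).hasDerivAt, fun x hx => ?_, fun x hx => ?_⟩
  · have h1 := congrFun (h.equation x hx) 0
    simp [Matrix.mulVec, dotProduct, Fin.sum_univ_two, UMat, muMat] at h1
    linear_combination h1
  · have h1 := congrFun (h.equation x hx) 1
    simp [Matrix.mulVec, dotProduct, Fin.sum_univ_two, UMat, muMat] at h1
    linear_combination h1

theorem IsLevel.disc_mul_fst {θ : ℝ} {t₁ t₂ : ℂ} {l : ℤ} {p p' : ℂ → C2}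
    (h : IsLevel θ t₁ t₂ l p p') {x : ℂ} (hx : x ∈ cutLambda θ t₁ t₂) :
    ((t₁ - x) ^ 2 - 4 * t₂) * p' x 0 = (t₁ - x) * (l + 1) * p x 0 - 2 * l * p x 1 := by
  linear_combination (t₁ - x) * h.fst x hx - 2 * h.snd x hx

theorem IsLevel.disc_mul_snd {θ : ℝ} {t₁ t₂ : ℂ} {l : ℤ} {p p' : ℂ → C2}
    (h : IsLevel θ t₁ t₂ l p p') {x : ℂ} (hx : x ∈ cutLambda θ t₁ t₂) :
    ((t₁ - x) ^ 2 - 4 * t₂) * p' x 1 = (t₁ - x) * l * p x 1 - 2 * t₂ * (l + 1) * p x 0 := by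
  linear_combination (t₁ - x) * h.snd x hx - 2 * t₂ * h.fst x hx

/-- The Wronskian of two solutions of level `l` times `((λ - u¹)(λ - u²))^{l + 1/2}` is
constant. -/
theorem exists_wronskian_eq {θ : ℝ} {t₁ t₂ : ℂ} (ht : t₂ ∈ cutPlane (2 * θ)) {l : ℤ}
    {p p' q q' : ℂ → C2} (hp : IsLevel θ t₁ t₂ l p p') (hq : IsLevel θ t₁ t₂ l q q') :
    ∃ c : ℂ, ∀ x ∈ cutLambda θ t₁ t₂, (p x 0 * q x 1 - p x 1 * q x 0) *
      exp (((l : ℂ) + 1 / 2) * (logBranch θ (x - canon θ t₁ t₂ 0)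
        + logBranch θ (x - canon θ t₁ t₂ 1))) = c := by
  have hd : ∀ x ∈ cutLambda θ t₁ t₂, HasDerivAt (fun x => (p x 0 * q x 1 - p x 1 * q x 0) *
      exp (((l : ℂ) + 1 / 2) * (logBranch θ (x - canon θ t₁ t₂ 0)
        + logBranch θ (x - canon θ t₁ t₂ 1)))) 0 x := by
    intro x hx
    have h1 := (((hp.apply hx 0).mul (hq.apply hx 1)).sub ((hp.apply hx 1).mul (hq.apply hx 0)))
    have h2 := ((((hasDerivAt_logBranch (hx 0)).comp_sub_const x _).add
      ((hasDerivAt_logBranch (hx 1)).comp_sub_const x _)).const_mul ((l : ℂ) + 1 / 2)).cexp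
    refine (h1.mul h2).congr_deriv ?_
    have h3 : (x - canon θ t₁ t₂ 0)⁻¹ + (x - canon θ t₁ t₂ 1)⁻¹
        = -2 * (t₁ - x) / ((t₁ - x) ^ 2 - 4 * t₂) := by
      have ha := sub_canon_ne_zero hx 0
      have hb := sub_canon_ne_zero hx 1
      rw [← canon_mul ht]
      field_simp
      simp only [canon, Matrix.cons_val_zero, Matrix.cons_val_one]
      ring
    have hD := disc_ne_zero ht hx
    have h4 : p' x 0 * q x 1 + p x 0 * q' x 1 - (p' x 1 * q x 0 + p x 1 * q' x 0)
        = (t₁ - x) * (2 * l + 1) * (p x 0 * q x 1 - p x 1 * q x 0)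
          / ((t₁ - x) ^ 2 - 4 * t₂) := by
      rw [eq_div_iff hD]
      linear_combination q x 1 * hp.disc_mul_fst hx + p x 0 * hq.disc_mul_snd hx
        - q x 0 * hp.disc_mul_snd hx - p x 1 * hq.disc_mul_fst hx
    simp only [Pi.sub_apply, Pi.mul_apply, Pi.add_apply]
    rw [h3, h4]
    ring
  exact (isOpen_cutLambda θ t₁ t₂).exists_is_const_of_deriv_eq_zero
    (isPreconnected_cutLambda θ t₁ t₂)
    (fun x hx => (hd x hx).differentiableAt.differentiableWithinAt)
    (fun x hx => (hd x hx).deriv)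

/-- The Wronskian of two solutions of the same level vanishes if both change sign around `u^i`:
continued along the loop it is invariant, while `((λ - u¹)(λ - u²))^{l + 1/2}` changes sign. -/
theorem IsPeriodVector.wronskian_eq_zero {θ : ℝ} {t₁ t₂ : ℂ} (ht : t₂ ∈ cutPlane (2 * θ))
    {i : Fin 2} {l : ℤ} {per : ℂ → C2} (h : IsPeriodVector θ t₁ t₂ i l per) :
    ∀ x ∈ cutLambda θ t₁ t₂, per x 0 * period θ t₁ t₂ i l x 1
      - per x 1 * period θ t₁ t₂ i l x 0 = 0 := by
  obtain ⟨c, hc⟩ := exists_wronskian_eq ht h.isLevel (isLevel_period ht i l)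
  suffices hc0 : c = 0 by
    intro x hx
    have := hc x hx
    rw [hc0] at this
    exact (mul_eq_zero.1 this).resolve_right (exp_ne_zero _)
  obtain ⟨j, hij⟩ : ∃ j : Fin 2, i ≠ j := exists_ne i |>.imp fun _ h => h.symm
  have hsum : ∀ x, logBranch θ (x - canon θ t₁ t₂ 0) + logBranch θ (x - canon θ t₁ t₂ 1)
      = logBranch θ (x - canon θ t₁ t₂ i) + logBranch θ (x - canon θ t₁ t₂ j) := by
    intro x
    fin_cases i <;> fin_cases j <;> simp_all [add_comm]
  choose H hH hHv hfH using hasLocalForm_period (t₁ := t₁) ht i l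
  have hj : ∀ᶠ x in 𝓝 (canon θ t₁ t₂ i), x - canon θ t₁ t₂ j ∈ cutPlane θ := by
    have h1 : Continuous fun x : ℂ => x - canon θ t₁ t₂ j := by fun_prop
    exact h1.continuousAt.eventually_mem
      ((isOpen_cutPlane θ).mem_nhds (canon_sub_canon_mem ht hij))
  obtain ⟨ρ₁, hρ₁⟩ := exists_strip (t₁ := t₁) ht i ((hfH 0).and (hfH 1))
    (((hH 0).eventually_analyticAt.and (hH 1).eventually_analyticAt).and hj)
  obtain ⟨ρ₂, J, hJd, hJper, hJanti⟩ := h.anti_invariant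
  set u := canon θ t₁ t₂ i with hu
  set κ : ℂ := (-1 : ℂ) ^ l / (Real.sqrt (2 * Real.pi) : ℂ) * Gamma ((l : ℂ) + 1 / 2) with hκ
  set F : ℂ → ℂ := fun s => κ * (J s 0 * H 1 (u + exp s) - J s 1 * H 0 (u + exp s)) *
    exp (((l : ℂ) + 1 / 2) * logBranch θ (u + exp s - canon θ t₁ t₂ j)) with hF
  set ρ := min ρ₁ ρ₂ with hρ
  set Ω : Set ℂ := {s | s.re < ρ} with hΩ
  have hΩo : IsOpen Ω := isOpen_lt continuous_re continuous_const
  have hΩc : IsPreconnected Ω := (convex_halfSpace_re_lt ρ).isPreconnected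
  have hFd : DifferentiableOn ℂ F Ω := by
    intro s hs
    have hs1 : s.re < ρ₁ := lt_of_lt_of_le hs (min_le_left _ _)
    have hs2 : s.re < ρ₂ := lt_of_lt_of_le hs (min_le_right _ _)
    obtain ⟨⟨ha0, ha1⟩, hsj⟩ := (hρ₁ s hs1).1
    have hexp : DifferentiableAt ℂ (fun s => u + exp s) s := by fun_prop
    have hJs : DifferentiableAt ℂ J s :=
      (hJd s hs2).differentiableAt ((isOpen_lt continuous_re continuous_const).mem_nhds hs2)
    have d0 : DifferentiableAt ℂ (fun s => H 0 (u + exp s)) s :=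
      DifferentiableAt.comp s ha0.differentiableAt hexp
    have d1 : DifferentiableAt ℂ (fun s => H 1 (u + exp s)) s :=
      DifferentiableAt.comp s ha1.differentiableAt hexp
    have dl : DifferentiableAt ℂ (fun s => logBranch θ (u + exp s - canon θ t₁ t₂ j)) s :=
      DifferentiableAt.comp (g := logBranch θ) (f := fun s => u + exp s - canon θ t₁ t₂ j) s
        (hasDerivAt_logBranch hsj).differentiableAt (hexp.sub_const _)
    have dJ : ∀ a, DifferentiableAt ℂ (fun s => J s a) s := differentiableAt_pi.1 hJs
    exact (((((dJ 0).mul d1).sub ((dJ 1).mul d0)).const_mul κ).mul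
      (dl.const_mul _).cexp).differentiableWithinAt
  have hFstrip : ∀ s ∈ Ω, θ - 2 * Real.pi < s.im → s.im < θ → F s = c := by
    intro s hs h1 h2
    have hs1 : s.re < ρ₁ := lt_of_lt_of_le hs (min_le_left _ _)
    have hs2 : s.re < ρ₂ := lt_of_lt_of_le hs (min_le_right _ _)
    obtain ⟨hcut, hlog, hP0, hP1⟩ := (hρ₁ s hs1).2 h1 h2
    have hW := hc _ hcut
    rw [hsum, hlog] at hW
    have hP0' : period θ t₁ t₂ i l (u + exp s) 0
        = κ * exp ((-(l : ℂ) - 1 / 2) * s) * H 0 (u + exp s) := by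
      rw [prefactor, ← hu, hlog] at hP0; exact hP0
    have hP1' : period θ t₁ t₂ i l (u + exp s) 1
        = κ * exp ((-(l : ℂ) - 1 / 2) * s) * H 1 (u + exp s) := by
      rw [prefactor, ← hu, hlog] at hP1; exact hP1
    have hexp : exp ((-(l : ℂ) - 1 / 2) * s) * exp (((l : ℂ) + 1 / 2) * s) = 1 := by
      rw [← exp_add, ← exp_zero]; congr 1; ring
    rw [hP0', hP1', mul_add, exp_add] at hW
    rw [← hW, hF]
    simp only
    rw [hJper s hs2 h1 h2]
    linear_combination (-κ * (per (u + exp s) 0 * H 1 (u + exp s)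
      - per (u + exp s) 1 * H 0 (u + exp s)) *
      exp (((l : ℂ) + 1 / 2) * logBranch θ (u + exp s - canon θ t₁ t₂ j))) * hexp
  set s₀ : ℂ := ⟨ρ - 1, θ - Real.pi⟩ with hs₀
  have hs₀Ω : s₀ ∈ Ω := by simp [hΩ, hs₀]
  have hpi := Real.pi_pos
  have hconst : Set.EqOn F (fun _ => c) Ω := by
    refine (hFd.analyticOnNhd hΩo).eqOn_of_preconnected_of_eventuallyEq
      analyticOnNhd_const hΩc hs₀Ω ?_
    have h1 : ∀ᶠ s in 𝓝 s₀, s.im ∈ Set.Ioo (θ - 2 * Real.pi) θ :=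
      continuous_im.continuousAt.eventually_mem (Ioo_mem_nhds (by simp [hs₀]; linarith)
        (by simp [hs₀]; linarith))
    filter_upwards [h1, hΩo.mem_nhds hs₀Ω] with s hs1 hs2 using hFstrip s hs2 hs1.1 hs1.2
  have hs₁Ω : s₀ + 2 * Real.pi * I ∈ Ω := by simp [hΩ, hs₀]
  have hanti : F (s₀ + 2 * Real.pi * I) = -F s₀ := by
    have hs2 : s₀.re < ρ₂ := lt_of_lt_of_le hs₀Ω (min_le_right _ _)
    simp only [hF]
    rw [hJanti s₀ hs2, exp_add s₀, exp_two_pi_mul_I, mul_one]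
    simp only [Pi.neg_apply]
    ring
  rw [hconst hs₀Ω, hconst hs₁Ω] at hanti
  exact self_eq_neg.1 hanti

theorem isOpen_backHalfPlane (θ M : ℝ) : IsOpen (backHalfPlane θ M) :=
  isOpen_lt (by fun_prop) continuous_const

theorem psiInv_apply_ne_zero {θ : ℝ} {t₂ : ℂ} (ht : t₂ ∈ cutPlane (2 * θ)) (i a : Fin 2) :
    (PsiInv θ t₂).mulVec (Pi.single i 1) a ≠ 0 := by
  obtain ⟨j, hij⟩ : ∃ j : Fin 2, i ≠ j := exists_ne i |>.imp fun _ h => h.symm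
  have h4 : (Real.sqrt 2 : ℂ) ≠ 0 := by
    exact_mod_cast (Real.sqrt_pos.2 (by norm_num : (0 : ℝ) < 2)).ne'
  have hc := root_ne_zero θ 0 t₂ j (canon θ 0 t₂ i)
  rw [psiInv_mulVec (t₁ := 0) ht hij]
  fin_cases a
  · exact div_ne_zero (div_ne_zero two_ne_zero hc) h4
  · exact div_ne_zero (div_ne_zero hc two_ne_zero) h4

/-- The axioms determine a period vector on the cut plane. By the vanishing of the Wronskian it is
locally a constant multiple of the explicit one, and the normalisation fixes the constant. -/
theorem IsPeriodVector.eq_period {θ : ℝ} {t₁ t₂ : ℂ} (ht : t₂ ∈ cutPlane (2 * θ))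
    {i : Fin 2} {l : ℤ} {per : ℂ → C2} (h : IsPeriodVector θ t₁ t₂ i l per) :
    ∀ x ∈ cutLambda θ t₁ t₂, per x = period θ t₁ t₂ i l x := by
  have hW := h.wronskian_eq_zero ht
  have hlp := h.isLevel
  have hlq := isLevel_period (t₁ := t₁) ht i l
  obtain ⟨H, hH, hHv, hfH⟩ := hasLocalForm_period (t₁ := t₁) ht i l 0
  obtain ⟨h', hh'O, hh'⟩ := h.normalised
  set u := canon θ t₁ t₂ i with hu
  set v := (PsiInv θ t₂).mulVec (Pi.single i 1) with hv
  have hv0 : v 0 ≠ 0 := psiInv_apply_ne_zero ht i 0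
  have hother : ∀ᶠ x in 𝓝 u, ∀ j, i ≠ j → x - canon θ t₁ t₂ j ∈ cutPlane θ := by
    rw [eventually_all]
    intro j
    by_cases hij : i = j
    · exact Eventually.of_forall fun x h => absurd hij h
    · have h1 : Continuous fun x : ℂ => x - canon θ t₁ t₂ j := by fun_prop
      filter_upwards [h1.continuousAt.eventually_mem
        ((isOpen_cutPlane θ).mem_nhds (canon_sub_canon_mem ht hij))] with x hx _ using hx
  have hHne : ∀ᶠ x in 𝓝 u, H x ≠ 0 := hH.continuousAt.eventually_ne (by rwa [hHv])
  obtain ⟨ε, hε, hball⟩ := Metric.eventually_nhds_iff_ball.1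
    ((eventually_nhdsWithin_iff.1 hfH).and (hother.and hHne))
  -- A half disc at `u^i` away from the cut.
  set B : Set ℂ := Metric.ball u ε ∩ backHalfPlane θ (u * exp (-(θ * I))).re with hB
  have hBo : IsOpen B := Metric.isOpen_ball.inter (isOpen_backHalfPlane _ _)
  have hBc : IsPreconnected B :=
    ((convex_ball u ε).inter (convex_backHalfPlane _ _)).isPreconnected
  have hBcut : B ⊆ cutLambda θ t₁ t₂ := by
    rintro x ⟨hx1, hx2⟩ j
    by_cases hij : i = j
    · subst hij
      apply mem_cutPlane_of_re_neg
      rw [sub_mul, sub_re]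
      exact sub_neg.2 hx2
    · exact (hball x hx1).2.1 j hij
  have hline : Tendsto (fun r : ℝ => u - r * exp (θ * I)) (𝓝[>] 0) (𝓝[B] u) := by
    have h1 : Continuous fun r : ℝ => u - r * exp (θ * I) := by fun_prop
    have h2 := h1.tendsto 0
    simp only [ofReal_zero, zero_mul, sub_zero] at h2
    have h3 := h2.mono_left (nhdsWithin_le_nhds (s := Set.Ioi 0))
    refine tendsto_nhdsWithin_iff.2 ⟨h3, ?_⟩
    filter_upwards [h3.eventually_mem (Metric.ball_mem_nhds u hε), eventually_mem_nhdsWithin]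
      with r hr1 hr2
    refine ⟨hr1, ?_⟩
    rw [backHalfPlane, Set.mem_ofPred_eq, sub_mul, mul_assoc, ← exp_add, sub_re]
    simpa using hr2
  have hne : (𝓝[B] u).NeBot := hline.neBot
  obtain ⟨z₀, hz₀⟩ : B.Nonempty := by
    obtain ⟨z, hz⟩ := (eventually_mem_nhdsWithin (a := u) (s := B)).exists
    exact ⟨z, hz⟩
  have hP : ∀ x ∈ B, period θ t₁ t₂ i l x 0 = prefactor θ t₁ t₂ i l x * H x := fun x hx =>
    (hball x hx.1).1 (hBcut hx)
  have hP0 : ∀ x ∈ B, period θ t₁ t₂ i l x 0 ≠ 0 := fun x hx => by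
    rw [hP x hx]
    exact mul_ne_zero (prefactor_ne_zero _ _ _ _ _ _) (hball x hx.1).2.2
  set f : ℂ → ℂ := fun x => per x 0 / period θ t₁ t₂ i l x 0 with hf
  have hfd : ∀ x ∈ B, HasDerivAt f 0 x := by
    intro x hx
    have hcut := hBcut hx
    refine ((hlp.apply hcut 0).div (hlq.apply hcut 0) (hP0 x hx)).congr_deriv ?_
    have hD := disc_ne_zero ht hcut
    rw [div_eq_zero_iff]
    left
    apply mul_left_cancel₀ hD
    linear_combination period θ t₁ t₂ i l x 0 * hlp.disc_mul_fst hcut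
      - per x 0 * hlq.disc_mul_fst hcut + 2 * (l : ℂ) * hW x hcut
  obtain ⟨k, hk⟩ := hBo.exists_is_const_of_deriv_eq_zero hBc
    (fun x hx => (hfd x hx).differentiableAt.differentiableWithinAt)
    (fun x hx => (hfd x hx).deriv)
  have hk1 : k = 1 := by
    have hh'0 : Tendsto (fun x => h' x 0) (𝓝[B] u) (𝓝 0) := by
      have h1 : Tendsto (fun x => x - u) (𝓝[cutLambda θ t₁ t₂] u) (𝓝 0) := by
        have h2 : Continuous fun x : ℂ => x - u := by fun_prop
        have h3 := h2.tendsto u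
        rw [sub_self] at h3
        exact h3.mono_left nhdsWithin_le_nhds
      have h2 := hh'O.trans_tendsto h1
      exact (tendsto_pi_nhds.1 h2 0).mono_left (nhdsWithin_mono u hBcut)
    have hlim : Tendsto (fun x => (v 0 + h' x 0) / H x) (𝓝[B] u) (𝓝 ((v 0 + 0) / v 0)) := by
      refine (hh'0.const_add _).div ?_ hv0
      rw [← hHv]
      exact hH.continuousAt.mono_left nhdsWithin_le_nhds
    rw [add_zero, div_self hv0] at hlim
    refine tendsto_nhds_unique (tendsto_const_nhds.congr' ?_) hlim
    filter_upwards [eventually_mem_nhdsWithin] with x hx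
    have h1 : per x 0 = prefactor θ t₁ t₂ i l x * (v 0 + h' x 0) :=
      congrFun (hh' x (hBcut hx)) 0
    rw [← hk x hx, hf]
    simp only
    rw [h1, hP x hx, mul_div_mul_left _ _ (prefactor_ne_zero _ _ _ _ _ _)]
  have hBeq : ∀ x ∈ B, per x = period θ t₁ t₂ i l x := by
    intro x hx
    have h0 : per x 0 = period θ t₁ t₂ i l x 0 := by
      have h1 : f x = 1 := (hk x hx).trans hk1
      exact (div_eq_one_iff_eq (hP0 x hx)).1 h1
    have h1 : per x 1 = period θ t₁ t₂ i l x 1 := by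
      have h2 := hW x (hBcut hx)
      rw [h0] at h2
      apply mul_left_cancel₀ (hP0 x hx)
      linear_combination -h2
    ext a
    fin_cases a
    exacts [h0, h1]
  have hopen := isOpen_cutLambda θ t₁ t₂
  have ha : AnalyticOnNhd ℂ per (cutLambda θ t₁ t₂) := DifferentiableOn.analyticOnNhd
    (fun x hx => (h.differentiableAt x hx).differentiableWithinAt) hopen
  have hb : AnalyticOnNhd ℂ (period θ t₁ t₂ i l) (cutLambda θ t₁ t₂) :=
    DifferentiableOn.analyticOnNhd
    (fun x hx => (hlq.hasDerivAt x hx).differentiableAt.differentiableWithinAt) hopen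
  refine ha.eqOn_of_preconnected_of_eventuallyEq hb (isPreconnected_cutLambda θ t₁ t₂)
    (hBcut hz₀) ?_
  filter_upwards [hBo.mem_nhds hz₀] with x hx using hBeq x hx

/-! ### Closed forms of the series at infinity -/

theorem formalDeriv_single (k : ℤ) (c : ℂ) (p : ℕ) (d : ℂ) :
    formalDeriv (Finsupp.single k c, Finsupp.single p d)
      = (Finsupp.single (k - 1) (k * c) + Finsupp.single ((p : ℤ) - 1) d,
          Finsupp.single (p - 1) (p * d)) := by
  rw [formalDeriv, Finsupp.sum_single_index (by simp), Finsupp.sum_single_index (by simp)]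
  simp

theorem formalInt_single (k p : ℕ) (c d : ℂ) :
    formalInt (Finsupp.single (k : ℤ) c, Finsupp.single p d)
      = (Finsupp.single ((k : ℤ) + 1) (c / ((k : ℂ) + 1))
          + Finsupp.single ((p : ℤ) + 1) (-(d / ((p : ℂ) + 1) ^ 2)),
          Finsupp.single (p + 1) (d / ((p : ℂ) + 1))) := by
  have hk : (k : ℤ) ≠ -1 := by omega
  rw [formalInt, Finsupp.sum_single_index (by simp [hk]), Finsupp.sum_single_index (by simp)]
  simp [hk]

theorem eval_single (θ : ℝ) (k : ℤ) (c : ℂ) (p : ℕ) (d x : ℂ) :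
    LogLaurent.eval θ (Finsupp.single k c, Finsupp.single p d) x
      = c * x ^ k + d * (x ^ p * logBranch θ x) := by
  rw [LogLaurent.eval, Finsupp.sum_single_index (by simp), Finsupp.sum_single_index (by simp)]

/-- The harmonic numbers, as complex numbers. -/
def harmonicC (m : ℕ) : ℂ := ∑ j ∈ Finset.range m, 1 / ((j : ℂ) + 1)

theorem formalInt_iterate (m : ℕ) (c d : ℂ) :
    formalInt^[m] (Finsupp.single 0 c, Finsupp.single 0 d)
      = (Finsupp.single (m : ℤ) ((c - d * harmonicC m) / (m.factorial : ℂ)),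
          Finsupp.single m (d / (m.factorial : ℂ))) := by
  induction m with
  | zero => simp [harmonicC]
  | succ m ih =>
    have h1 : (m : ℂ) + 1 ≠ 0 := by exact_mod_cast Nat.succ_ne_zero m
    have h2 : (m.factorial : ℂ) ≠ 0 := by exact_mod_cast m.factorial_ne_zero
    rw [Function.iterate_succ_apply', ih, formalInt_single, ← Finsupp.single_add, harmonicC,
      harmonicC, Finset.sum_range_succ, Nat.factorial_succ]
    push_cast
    congr 2
    · field_simp
      ring
    · field_simp

theorem formalDeriv_iterate (m : ℕ) (c d : ℂ) :
    formalDeriv^[m + 1] (Finsupp.single 0 c, Finsupp.single 0 d)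
      = (Finsupp.single (-((m : ℤ) + 1)) ((-1) ^ m * (m.factorial : ℂ) * d),
          Finsupp.single 0 0) := by
  induction m with
  | zero =>
    rw [zero_add, Function.iterate_one, formalDeriv_single]
    simp
  | succ m ih =>
    rw [Function.iterate_succ_apply', ih, formalDeriv_single, Nat.factorial_succ]
    simp only [Finsupp.single_zero, add_zero, mul_zero]
    congr 2
    push_cast; ring

/-- The function given by `∂^l (c + d log λ)`. -/
def tower (θ : ℝ) (c d : ℂ) : ℤ → ℂ → ℂ
  | 0, x => c + d * logBranch θ x
  | Int.ofNat (m + 1), x => (-1) ^ m * (m.factorial : ℂ) * d * (x ^ (m + 1))⁻¹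
  | Int.negSucc m, x => x ^ (m + 1) / ((m + 1).factorial : ℂ) *
      (c + d * (logBranch θ x - harmonicC (m + 1)))

theorem eval_formalPow (θ : ℝ) (c d : ℂ) (l : ℤ) (x : ℂ) :
    (formalPow l (Finsupp.single 0 c, Finsupp.single 0 d)).eval θ x = tower θ c d l x := by
  match l with
  | Int.ofNat 0 =>
    rw [formalPow, Function.iterate_zero, id, eval_single]
    simp [tower]
  | Int.ofNat (m + 1) =>
    rw [formalPow, formalDeriv_iterate, eval_single, tower, zero_mul, add_zero, zpow_neg]
    rfl
  | Int.negSucc m =>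
    rw [formalPow, formalInt_iterate, eval_single, tower, zpow_natCast]
    ring

/-- The constant term of `I^{(-1)}_{e_i,∞}`. -/
def perInftyConst (ψ : ℂ) (i : Fin 2) : ℂ := ψ / 2 + ![0, Real.pi * I] i

theorem tower_add (θ : ℝ) (c c' d d' : ℂ) (l : ℤ) (x : ℂ) :
    tower θ c d l x + tower θ c' d' l x = tower θ (c + c') (d + d') l x := by
  match l with
  | Int.ofNat 0 => simp only [tower]; ring
  | Int.ofNat (m + 1) => simp only [tower]; ring
  | Int.negSucc m => simp only [tower]; ring

theorem perInfty_eq (θ : ℝ) (ψ : ℂ) (i : Fin 2) (l : ℤ) (x : ℂ) :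
    perInfty θ ψ i l x
      = ![tower θ (perInftyConst ψ i) 1 (l + 1) x, tower θ (1 / 2) 0 l x] := by
  have h1 : ∀ c, LogLaurent.logX + LogLaurent.const c
      = (Finsupp.single 0 c, Finsupp.single 0 1) := fun c => by
    simp [LogLaurent.logX, LogLaurent.const]
  have h2 : ∀ c, LogLaurent.const c = (Finsupp.single 0 c, Finsupp.single 0 0) := fun c => by
    simp [LogLaurent.const]
  fin_cases i
  · simp only [perInfty, h1, perInftyConst]
    simp only [h2, eval_formalPow]
    simp
  · simp only [perInfty, h1, perInftyConst]
    simp only [h2, eval_formalPow, tower_add]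
    simp

theorem mul_tower_succ (θ : ℝ) (c d : ℂ) (l : ℤ) {x : ℂ} (hx : x ≠ 0) :
    x * tower θ c d (l + 1) x = tower θ d 0 l x - l * tower θ c d l x := by
  match l with
  | Int.ofNat 0 =>
    simp [tower]
    field_simp
  | Int.ofNat (m + 1) =>
    have h : tower θ c d (Int.ofNat (m + 1) + 1) x
      = (-1) ^ (m + 1) * ((m + 1).factorial : ℂ) * d * (x ^ (m + 1 + 1))⁻¹ := rfl
    rw [h, tower, tower, Nat.factorial_succ, pow_succ x (m + 1), mul_inv]
    push_cast
    simp only [mul_zero, zero_mul, Int.ofNat_eq_natCast, Int.cast_natCast]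
    push_cast
    field_simp
    ring
  | Int.negSucc 0 =>
    have h : tower θ c d (Int.negSucc 0 + 1) x = c + d * logBranch θ x := rfl
    rw [h]
    simp [tower, harmonicC]
    ring
  | Int.negSucc (m + 1) =>
    have h : tower θ c d (Int.negSucc (m + 1) + 1) x = x ^ (m + 1) / ((m + 1).factorial : ℂ) *
      (c + d * (logBranch θ x - harmonicC (m + 1))) := rfl
    have h1 : (m : ℂ) + 1 + 1 ≠ 0 := by exact_mod_cast Nat.succ_ne_zero (m + 1)
    have h2 : ((m + 1).factorial : ℂ) ≠ 0 := by exact_mod_cast (m + 1).factorial_ne_zero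
    have h3 : harmonicC (m + 1 + 1) = harmonicC (m + 1) + 1 / ((m : ℂ) + 1 + 1) := by
      rw [harmonicC, Finset.sum_range_succ, ← harmonicC]; push_cast; rfl
    rw [h, tower, tower, h3, Nat.factorial_succ (m + 1), Int.negSucc_eq]
    push_cast
    field_simp
    ring

theorem hasDerivAt_tower {θ : ℝ} (c d : ℂ) (n : ℕ) {x : ℂ} (hx : x ∈ cutPlane θ) :
    HasDerivAt (tower θ c d n) (tower θ c d (n + 1) x) x := by
  have hx0 := ne_zero_of_mem_cutPlane hx
  match n with
  | 0 =>
    refine (((hasDerivAt_logBranch hx).const_mul d).const_add c).congr_deriv ?_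
    change _ = (-1) ^ 0 * ((Nat.factorial 0 : ℕ) : ℂ) * d * (x ^ (0 + 1))⁻¹
    simp
  | m + 1 =>
    refine (((hasDerivAt_pow (m + 1) x).inv (pow_ne_zero _ hx0)).const_mul
      ((-1) ^ m * (m.factorial : ℂ) * d)).congr_deriv ?_
    change _ = (-1) ^ (m + 1) * ((m + 1).factorial : ℂ) * d * (x ^ (m + 1 + 1))⁻¹
    rw [Nat.factorial_succ]
    push_cast
    field_simp
    ring

/-- `(R - λ) I^{(l+1)}_∞ = (μ + l + 1/2) I^{(l)}_∞`, first component. -/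
theorem perInfty_fst (θ : ℝ) (ψ : ℂ) (i : Fin 2) (l : ℤ) {x : ℂ} (hx : x ≠ 0) :
    -x * perInfty θ ψ i (l + 1) x 0 + 2 * perInfty θ ψ i (l + 1) x 1
      = (l + 1) * perInfty θ ψ i l x 0 := by
  have h := mul_tower_succ θ (perInftyConst ψ i) 1 (l + 1) hx
  have h2 := tower_add θ (1 / 2) (1 / 2) 0 0 (l + 1) x
  norm_num at h2
  simp only [perInfty_eq, Matrix.cons_val_zero, Matrix.cons_val_one, Matrix.cons_val_fin_one]
  push_cast at h
  norm_num
  linear_combination -h + h2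

/-- `(R - λ) I^{(l+1)}_∞ = (μ + l + 1/2) I^{(l)}_∞`, second component. -/
theorem perInfty_snd (θ : ℝ) (ψ : ℂ) (i : Fin 2) (l : ℤ) {x : ℂ} (hx : x ≠ 0) :
    -x * perInfty θ ψ i (l + 1) x 1 = l * perInfty θ ψ i l x 1 := by
  have h := mul_tower_succ θ (1 / 2) 0 l hx
  have h0 : tower θ 0 0 l x = 0 := by
    match l with
    | Int.ofNat 0 => simp [tower]
    | Int.ofNat (m + 1) => simp [tower]
    | Int.negSucc m => simp [tower]
  simp only [perInfty_eq, Matrix.cons_val_one, Matrix.cons_val_fin_one]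
  linear_combination -h - h0

theorem perInfty_neg_one (θ : ℝ) (ψ : ℂ) (i : Fin 2) (x : ℂ) :
    perInfty θ ψ i (-1) x = ![perInftyConst ψ i + logBranch θ x, x / 2] := by
  rw [perInfty_eq, neg_add_cancel]
  have h1 : tower θ (1 / 2) 0 (-1) x = x ^ (0 + 1) / ((0 + 1).factorial : ℂ) *
    (1 / 2 + 0 * (logBranch θ x - harmonicC (0 + 1))) := rfl
  rw [h1]
  simp [tower]
  ring

theorem perInfty_zero (θ : ℝ) (ψ : ℂ) (i : Fin 2) (x : ℂ) :
    perInfty θ ψ i 0 x = ![x⁻¹, 1 / 2] := by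
  rw [perInfty_eq, zero_add]
  have h1 : tower θ (perInftyConst ψ i) 1 1 x
    = (-1) ^ 0 * ((Nat.factorial 0 : ℕ) : ℂ) * 1 * (x ^ (0 + 1))⁻¹ := rfl
  rw [h1]
  simp [tower]

theorem hasDerivAt_perInfty {θ : ℝ} (ψ : ℂ) (i : Fin 2) (k : ℕ) (a : Fin 2) {x : ℂ}
    (hx : x ∈ cutPlane θ) :
    HasDerivAt (fun x => perInfty θ ψ i (-1 + k) x a) (perInfty θ ψ i (0 + k) x a) x := by
  simp only [perInfty_eq]
  fin_cases a
  · simp only [Fin.zero_eta, Matrix.cons_val_zero, zero_add, neg_add_cancel_comm]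
    exact hasDerivAt_tower _ _ k hx
  · simp only [Fin.mk_one, Matrix.cons_val_one, Matrix.cons_val_fin_one, zero_add]
    match k with
    | 0 =>
      have h1 : ∀ y, tower θ (1 / 2) 0 (-1 + ((0 : ℕ) : ℤ)) y = y / 2 := fun y => by
        have h2 := congrFun (perInfty_neg_one θ ψ i y) 1
        rw [perInfty_eq] at h2
        exact h2
      have h3 : tower θ (1 / 2) 0 ((0 : ℕ) : ℤ) x = 1 / 2 := by simp [tower]
      simp only [h1]
      rw [h3]
      exact (hasDerivAt_id' x).div_const 2
    | k + 1 =>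
      rw [show (-1 : ℤ) + ((k + 1 : ℕ) : ℤ) = (k : ℤ) by push_cast; ring]
      exact hasDerivAt_tower _ _ k hx

/-! ### Estimates at infinity -/

theorem eventually_ne_zero_of_le_cobounded {F : Filter ℂ} (hF : F ≤ Bornology.cobounded ℂ) :
    ∀ᶠ x in F, x ≠ 0 := hF (Bornology.eventually_ne_cobounded 0)

theorem tendsto_inv_of_le_cobounded {F : Filter ℂ} (hF : F ≤ Bornology.cobounded ℂ) :
    Tendsto (fun x : ℂ => x⁻¹) F (𝓝 0) := tendsto_inv₀_cobounded.mono_left hF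

theorem isBigO_mul_zpow {F : Filter ℂ} (hF : F ≤ Bornology.cobounded ℂ) {f g : ℂ → ℂ} {a b c : ℤ}
    (hf : f =O[F] fun x => ‖x‖ ^ a) (hg : g =O[F] fun x => ‖x‖ ^ b) (hc : a + b = c) :
    (fun x => f x * g x) =O[F] fun x => ‖x‖ ^ c := by
  refine (hf.mul hg).congr' EventuallyEq.rfl ?_
  filter_upwards [eventually_ne_zero_of_le_cobounded hF] with x hx
  rw [← hc, zpow_add₀ (norm_ne_zero_iff.2 hx)]

theorem isBigO_zpow_mono {F : Filter ℂ} (hF : F ≤ Bornology.cobounded ℂ) {f : ℂ → ℂ} {a b : ℤ}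
    (hf : f =O[F] fun x => ‖x‖ ^ a) (hab : a ≤ b) : f =O[F] fun x => ‖x‖ ^ b := by
  refine hf.trans (IsBigO.of_bound 1 ?_)
  have h1 : ∀ᶠ x : ℂ in F, 1 ≤ ‖x‖ :=
    hF (tendsto_norm_cobounded_atTop.eventually (eventually_ge_atTop 1))
  filter_upwards [h1] with x hx
  rw [one_mul, Real.norm_of_nonneg (by positivity), Real.norm_of_nonneg (by positivity)]
  exact zpow_le_zpow_right₀ hx hab

theorem isBigO_of_tendsto {F : Filter ℂ} {f : ℂ → ℂ} {c : ℂ} (hf : Tendsto f F (𝓝 c)) :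
    f =O[F] fun x => ‖x‖ ^ (0 : ℤ) := by
  simpa using hf.isBigO_one ℝ

theorem isBigO_const_zpow {F : Filter ℂ} (c : ℂ) : (fun _ : ℂ => c) =O[F] fun x => ‖x‖ ^ (0 : ℤ) :=
  isBigO_of_tendsto tendsto_const_nhds

theorem isBigO_id_zpow {F : Filter ℂ} : (fun x : ℂ => x) =O[F] fun x => ‖x‖ ^ (1 : ℤ) := by
  refine IsBigO.of_bound 1 (Eventually.of_forall fun x => ?_)
  simp

theorem isBigO_sub_id_zpow {F : Filter ℂ} (hF : F ≤ Bornology.cobounded ℂ) (t : ℂ) :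
    (fun x : ℂ => t - x) =O[F] fun x => ‖x‖ ^ (1 : ℤ) :=
  (isBigO_zpow_mono hF (isBigO_const_zpow t) (by norm_num)).sub isBigO_id_zpow

theorem isBigO_inv_zpow {F : Filter ℂ} : (fun x : ℂ => x⁻¹) =O[F] fun x => ‖x‖ ^ (-1 : ℤ) := by
  refine IsBigO.of_bound 1 (Eventually.of_forall fun x => ?_)
  simp

theorem tendsto_disc_div_sq {F : Filter ℂ} (hF : F ≤ Bornology.cobounded ℂ) (t₁ t₂ : ℂ) :
    Tendsto (fun x : ℂ => ((t₁ - x) ^ 2 - 4 * t₂) * (x⁻¹ * x⁻¹)) F (𝓝 1) := by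
  have h := tendsto_inv_of_le_cobounded hF
  have h1 : Tendsto (fun x : ℂ => (t₁ * x⁻¹ - 1) ^ 2 - 4 * t₂ * (x⁻¹ * x⁻¹)) F
      (𝓝 ((t₁ * 0 - 1) ^ 2 - 4 * t₂ * (0 * 0))) :=
    (((h.const_mul t₁).sub_const 1).pow 2).sub ((h.mul h).const_mul _)
  norm_num at h1
  refine h1.congr' ?_
  filter_upwards [eventually_ne_zero_of_le_cobounded hF] with x hx
  field_simp

theorem eventually_disc_ne_zero {F : Filter ℂ} (hF : F ≤ Bornology.cobounded ℂ) (t₁ t₂ : ℂ) :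
    ∀ᶠ x in F, (t₁ - x) ^ 2 - 4 * t₂ ≠ 0 := by
  filter_upwards [(tendsto_disc_div_sq hF t₁ t₂).eventually_ne one_ne_zero] with x hx h
  exact hx (by rw [h, zero_mul])

theorem isBigO_inv_disc {F : Filter ℂ} (hF : F ≤ Bornology.cobounded ℂ) (t₁ t₂ : ℂ) :
    (fun x : ℂ => ((t₁ - x) ^ 2 - 4 * t₂)⁻¹) =O[F] fun x => ‖x‖ ^ (-2 : ℤ) := by
  have h1 := isBigO_of_tendsto ((tendsto_disc_div_sq hF t₁ t₂).inv₀ one_ne_zero)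
  have h2 := isBigO_mul_zpow hF h1 (isBigO_mul_zpow hF isBigO_inv_zpow isBigO_inv_zpow rfl) rfl
  refine h2.congr' ?_ (by norm_num)
  filter_upwards [eventually_ne_zero_of_le_cobounded hF] with x hx
  field_simp

/-- A family `X n` satisfies the period equations up to the source terms `Y n`. -/
def SourcedEquation (t₁ t₂ : ℂ) (F : Filter ℂ) (X Y : ℤ → ℂ → C2) (n : ℤ) : Prop :=
  ∀ᶠ x in F, (t₁ - x) * X (n + 1) x 0 + 2 * X (n + 1) x 1 = (n + 1) * X n x 0 + Y n x 0 ∧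
    2 * t₂ * X (n + 1) x 0 + (t₁ - x) * X (n + 1) x 1 = n * X n x 1 + Y n x 1

/-- The equations `(U - λ) X (n + 1) = (μ + n + 1/2) X n + Y n` can be solved for `X (n + 1)` at
the cost of a factor `O(λ⁻¹)`, and for `X n` at the cost of a factor `O(λ)` unless `n = 0, -1`.
Hence a bound at level `-1` gives the corresponding bounds at all levels. -/
theorem isBigO_of_sourcedEquation {t₁ t₂ : ℂ} {F : Filter ℂ} (hF : F ≤ Bornology.cobounded ℂ)
    {X Y : ℤ → ℂ → C2} {K : ℤ} (heq : ∀ n, SourcedEquation t₁ t₂ F X Y n)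
    (hY : ∀ n a, (fun x => Y n x a) =O[F] fun x => ‖x‖ ^ (-(n + K)))
    (hX : ∀ a, (fun x => X (-1) x a) =O[F] fun x => ‖x‖ ^ (1 - K)) (n : ℤ) :
    ∀ a, (fun x => X n x a) =O[F] fun x => ‖x‖ ^ (-(n + K)) := by
  have hw := isBigO_sub_id_zpow hF t₁
  have hD := isBigO_inv_disc hF t₁ t₂
  have hup : ∀ n : ℤ, (∀ a, (fun x => X n x a) =O[F] fun x => ‖x‖ ^ (-(n + K))) →
      ∀ a, (fun x => X (n + 1) x a) =O[F] fun x => ‖x‖ ^ (-(n + 1 + K)) := by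
    intro n h
    have hs0 : (fun x => (n + 1) * X n x 0 + Y n x 0) =O[F] fun x => ‖x‖ ^ (-(n + K)) :=
      ((h 0).const_mul_left _).add (hY n 0)
    have hs1 : (fun x => n * X n x 1 + Y n x 1) =O[F] fun x => ‖x‖ ^ (-(n + K)) :=
      ((h 1).const_mul_left _).add (hY n 1)
    have hwD := isBigO_mul_zpow hF hw hD (c := -1) (by norm_num)
    have hD1 := isBigO_zpow_mono hF hD (b := -1) (by norm_num)
    intro a
    fin_cases a
    · refine ((isBigO_mul_zpow hF hwD hs0 (c := -(n + 1 + K)) (by ring)).sub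
        ((isBigO_mul_zpow hF hD1 hs1 (c := -(n + 1 + K)) (by ring)).const_mul_left 2)).congr' ?_
        EventuallyEq.rfl
      filter_upwards [heq n, eventually_disc_ne_zero hF t₁ t₂] with x hx hx0
      rw [← hx.1, ← hx.2]
      simp only [Fin.zero_eta]
      field_simp
      ring
    · refine ((isBigO_mul_zpow hF hwD hs1 (c := -(n + 1 + K)) (by ring)).sub
        ((isBigO_mul_zpow hF hD1 hs0 (c := -(n + 1 + K)) (by ring)).const_mul_left
          (2 * t₂))).congr' ?_ EventuallyEq.rfl
      filter_upwards [heq n, eventually_disc_ne_zero hF t₁ t₂] with x hx hx0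
      rw [← hx.1, ← hx.2]
      simp only [Fin.mk_one]
      field_simp
      ring
  have hdown : ∀ n : ℤ, (n : ℂ) ≠ 0 → (n : ℂ) + 1 ≠ 0 →
      (∀ a, (fun x => X (n + 1) x a) =O[F] fun x => ‖x‖ ^ (-(n + 1 + K))) →
      ∀ a, (fun x => X n x a) =O[F] fun x => ‖x‖ ^ (-(n + K)) := by
    intro n h0 h1 h
    have h' : ∀ a, (fun x => X (n + 1) x a) =O[F] fun x => ‖x‖ ^ (-(n + K)) := fun a =>
      isBigO_zpow_mono hF (h a) (by linarith)
    intro a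
    fin_cases a
    · refine ((((isBigO_mul_zpow hF hw (h 0) (c := -(n + K)) (by ring)).add
        ((h' 1).const_mul_left 2)).sub (hY n 0)).const_mul_left (((n : ℂ) + 1)⁻¹)).congr' ?_
        EventuallyEq.rfl
      filter_upwards [heq n] with x hx
      rw [hx.1, add_sub_cancel_right, inv_mul_cancel_left₀ h1]
      rfl
    · refine (((((h' 0).const_mul_left (2 * t₂)).add
        (isBigO_mul_zpow hF hw (h 1) (c := -(n + K)) (by ring))).sub
        (hY n 1)).const_mul_left ((n : ℂ)⁻¹)).congr' ?_ EventuallyEq.rfl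
      filter_upwards [heq n] with x hx
      rw [hx.2, add_sub_cancel_right, inv_mul_cancel_left₀ h0]
      rfl
  have hX' : ∀ a, (fun x => X (-1) x a) =O[F] fun x => ‖x‖ ^ (-(-1 + K)) := by
    simpa [neg_add_rev, sub_eq_add_neg, add_comm] using hX
  match n with
  | Int.ofNat n =>
    induction n with
    | zero => exact hup (-1) hX'
    | succ n ih => exact hup _ ih
  | Int.negSucc n =>
    induction n with
    | zero => exact hX'
    | succ n ih =>
      refine hdown (Int.negSucc (n + 1)) ?_ ?_ ih
      · exact_mod_cast Int.negSucc_ne_zero (n + 1)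
      · have : Int.negSucc (n + 1) + 1 ≠ 0 := Int.negSucc_ne_zero n
        exact_mod_cast this

/-! ### The far part of a sector -/

/-- The filter of points of the sector that tend to infinity. -/
def farSector (θ δ : ℝ) : Filter ℂ := Bornology.cobounded ℂ ⊓ 𝓟 (sector θ δ)

theorem farSector_le (θ δ : ℝ) : farSector θ δ ≤ Bornology.cobounded ℂ := inf_le_left

theorem eventually_mem_sector (θ δ : ℝ) : ∀ᶠ x in farSector θ δ, x ∈ sector θ δ :=
  mem_inf_of_right (mem_principal_self _)

theorem eventually_farSector_iff {θ δ : ℝ} {p : ℂ → Prop} :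
    (∀ᶠ x in farSector θ δ, p x) ↔ ∃ R : ℝ, ∀ x ∈ sector θ δ, R ≤ ‖x‖ → p x := by
  rw [farSector, eventually_inf_principal, ← comap_norm_atTop,
    (atTop_basis.comap (norm : ℂ → ℝ)).eventually_iff]
  simp only [true_and, Set.mem_preimage, Set.mem_Ici]
  exact exists_congr fun R => ⟨fun h x hx hR => h hR hx, fun h x hR hx => h x hx hR⟩

theorem mul_mem_sector {θ δ : ℝ} {x : ℂ} (hx : x ∈ sector θ δ) (hx0 : x ≠ 0) {r : ℝ}
    (hr : 0 < r) : (r : ℂ) * x ∈ sector θ δ := by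
  have : (logBranch θ (r * x)).im = (logBranch θ x).im := by
    rw [logBranch_ofReal_mul θ hr hx0, add_im, ofReal_im, zero_add]
  rw [sector, Set.mem_ofPred_eq, this]
  exact hx

theorem tendsto_mul_farSector {θ δ : ℝ} {x : ℂ} (hx : x ∈ sector θ δ) (hx0 : x ≠ 0) :
    Tendsto (fun r : ℝ => (r : ℂ) * x) atTop (farSector θ δ) := by
  refine tendsto_inf.2 ⟨?_, tendsto_principal.2 ?_⟩
  · rw [← tendsto_norm_atTop_iff_cobounded]
    have h1 : Tendsto (fun r : ℝ => r * ‖x‖) atTop atTop :=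
      tendsto_id.atTop_mul_const (norm_pos_iff.2 hx0)
    refine h1.congr' ?_
    filter_upwards [eventually_ge_atTop 0] with r hr
    rw [norm_mul, norm_real, Real.norm_of_nonneg hr]
  · filter_upwards [eventually_gt_atTop 0] with r hr using mul_mem_sector hx hx0 hr

/-- Integration from infinity along rays: a function that tends to `0` and whose derivative is
`O(|λ|^{-N-1})` with `N ≥ 1` is `O(|λ|^{-N})`. -/
theorem isBigO_of_hasDerivAt {θ δ : ℝ} {f f' : ℂ → ℂ} {N : ℤ} (hN : 1 ≤ N)
    (hd : ∀ᶠ x in farSector θ δ, HasDerivAt f (f' x) x)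
    (hf' : f' =O[farSector θ δ] fun x => ‖x‖ ^ (-(N + 1)))
    (hf : Tendsto f (farSector θ δ) (𝓝 0)) :
    f =O[farSector θ δ] fun x => ‖x‖ ^ (-N) := by
  obtain ⟨C, hC0, hC⟩ := hf'.exists_nonneg
  obtain ⟨R, hR⟩ := eventually_farSector_iff.1 (hd.and hC.bound)
  refine IsBigO.of_bound C ?_
  refine eventually_farSector_iff.2 ⟨max R 1, fun x hx hxR => ?_⟩
  have hx1 : 1 ≤ ‖x‖ := (le_max_right _ _).trans hxR
  have hxR' : R ≤ ‖x‖ := (le_max_left _ _).trans hxR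
  have hxpos : 0 < ‖x‖ := by linarith
  have hx0 : x ≠ 0 := norm_pos_iff.1 hxpos
  have hray : ∀ r : ℝ, 1 ≤ r → HasDerivAt f (f' (r * x)) (r * x) ∧
      ‖f' (r * x)‖ ≤ C * (r * ‖x‖) ^ (-(N + 1)) := by
    intro r hr
    have hr0 : 0 < r := by linarith
    have hn : ‖(r : ℂ) * x‖ = r * ‖x‖ := by
      rw [norm_mul, norm_real, Real.norm_of_nonneg hr0.le]
    obtain ⟨h1, h2⟩ := hR (r * x) (mul_mem_sector hx hx0 hr0) (by
      rw [hn]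
      exact hxR'.trans (le_mul_of_one_le_left hxpos.le hr))
    rw [hn, Real.norm_of_nonneg (by positivity)] at h2
    exact ⟨h1, h2⟩
  have hmain : ∀ b : ℝ, 1 ≤ b → ‖f (b * x) - f x‖ ≤ C * ‖x‖ ^ (-N) * (1 - b⁻¹) := by
    intro b hb
    have hφ : ∀ r : ℝ, 1 ≤ r → HasDerivAt (fun r : ℝ => f (r * x) - f x) (f' (r * x) * x) r := by
      intro r hr
      have h1 : HasDerivAt (fun r : ℝ => (r : ℂ) * x) (1 * x) r :=
        (ofRealCLM.hasDerivAt (x := r)).mul_const x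
      rw [one_mul] at h1
      exact ((hray r hr).1.comp r h1).sub_const (f x)
    have hB : ∀ r : ℝ, 1 ≤ r → HasDerivAt (fun r : ℝ => C * ‖x‖ ^ (-N) * (1 - r⁻¹))
        (C * ‖x‖ ^ (-N) * (r ^ 2)⁻¹) r := by
      intro r hr
      have h1 := ((hasDerivAt_inv (by linarith : r ≠ 0)).const_sub 1).const_mul (C * ‖x‖ ^ (-N))
      rwa [neg_neg] at h1
    refine image_norm_le_of_norm_deriv_right_le_deriv_boundary' (a := 1) (b := b)
      (f := fun r : ℝ => f (r * x) - f x)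
      (f' := fun r : ℝ => f' (r * x) * x)
      (B := fun r => C * ‖x‖ ^ (-N) * (1 - r⁻¹))
      (B' := fun r => C * ‖x‖ ^ (-N) * (r ^ 2)⁻¹) ?_ ?_ ?_ ?_ ?_ ?_ ⟨hb, le_rfl⟩
    · exact fun r hr => (hφ r hr.1).continuousAt.continuousWithinAt
    · exact fun r hr => (hφ r hr.1).hasDerivWithinAt
    · simp
    · exact fun r hr => (hB r hr.1).continuousAt.continuousWithinAt
    · exact fun r hr => (hB r hr.1).hasDerivWithinAt
    · intro r hr
      have hr1 : 1 ≤ r := hr.1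
      have hr0 : 0 < r := by linarith
      rw [norm_mul]
      calc ‖f' (r * x)‖ * ‖x‖ ≤ C * (r * ‖x‖) ^ (-(N + 1)) * ‖x‖ := by
            gcongr
            exact (hray r hr1).2
        _ = C * ‖x‖ ^ (-N) * r ^ (-(N + 1)) := by
            rw [mul_zpow, neg_add, zpow_add₀ hxpos.ne', zpow_neg_one]
            field_simp
        _ ≤ C * ‖x‖ ^ (-N) * (r ^ 2)⁻¹ := by
            gcongr
            rw [← zpow_natCast, ← zpow_neg]
            exact zpow_le_zpow_right₀ hr1 (by push_cast; linarith)
  have hlim : Tendsto (fun b : ℝ => ‖f (b * x) - f x‖) atTop (𝓝 ‖0 - f x‖) :=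
    ((hf.comp (tendsto_mul_farSector hx hx0)).sub_const (f x)).norm
  rw [zero_sub, norm_neg] at hlim
  rw [Real.norm_of_nonneg (by positivity)]
  refine le_of_tendsto hlim ?_
  filter_upwards [eventually_ge_atTop 1] with b hb
  refine (hmain b hb).trans ?_
  have hb0 : 0 ≤ b⁻¹ := by positivity
  exact mul_le_of_le_one_right (by positivity) (by linarith)

/-! ### The explicit period vectors near infinity -/

theorem eventually_logBranch_sub {θ δ : ℝ} (hδ : 0 < δ) (u : ℂ) :
    ∀ᶠ x in farSector θ δ, x - u ∈ cutPlane θ ∧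
      logBranch θ (x - u) = logBranch θ x + log (1 - u * x⁻¹) := by
  have h1 : Tendsto (fun x : ℂ => 1 - u * x⁻¹) (farSector θ δ) (𝓝 1) := by
    simpa using ((tendsto_inv_of_le_cobounded (farSector_le θ δ)).const_mul u).const_sub 1
  have h2 : Tendsto (fun x : ℂ => (log (1 - u * x⁻¹)).im) (farSector θ δ) (𝓝 0) := by
    have h := (h1.clog one_mem_slitPlane)
    rw [log_one] at h
    exact (continuous_im.tendsto 0).comp h
  filter_upwards [eventually_mem_sector θ δ,
    eventually_ne_zero_of_le_cobounded (farSector_le θ δ), h1.eventually_ne one_ne_zero,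
    h2.eventually (Ioo_mem_nhds (neg_lt_zero.2 hδ) hδ)] with x hx hx0 hx1 hx2
  have hexp : x - u = exp (logBranch θ x + log (1 - u * x⁻¹)) := by
    rw [exp_add, exp_logBranch θ hx0, exp_log hx1]
    field_simp
  have him : (logBranch θ x + log (1 - u * x⁻¹)).im ∈ Set.Ioo (θ - 2 * Real.pi) θ := by
    rw [add_im]
    have h3 := hx.1
    have h4 := hx.2
    constructor <;> linarith [hx2.1, hx2.2]
  rw [hexp]
  exact ⟨exp_mem_cutPlane him.1 him.2, logBranch_exp him.1 him.2.le⟩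

theorem eventually_mem_cutPlane {θ δ : ℝ} (hδ : 0 < δ) :
    ∀ᶠ x in farSector θ δ, x ∈ cutPlane θ := by
  filter_upwards [eventually_logBranch_sub (θ := θ) hδ 0] with x hx
  simpa using hx.1

theorem eventually_mem_cutLambda {θ δ : ℝ} (hδ : 0 < δ) (t₁ t₂ : ℂ) :
    ∀ᶠ x in farSector θ δ, x ∈ cutLambda θ t₁ t₂ := by
  have : ∀ᶠ x in farSector θ δ, ∀ i, x - canon θ t₁ t₂ i ∈ cutPlane θ :=
    eventually_all.2 fun i => (eventually_logBranch_sub hδ _).mono fun x hx => hx.1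
  exact this

/-- The logarithm of `(1 - u^i / λ)^{1/2}`. -/
def logRatio (θ : ℝ) (t₁ t₂ : ℂ) (i : Fin 2) (x : ℂ) : ℂ :=
  log (1 - canon θ t₁ t₂ i * x⁻¹) / 2

theorem tendsto_logRatio (θ δ : ℝ) (t₁ t₂ : ℂ) (i : Fin 2) :
    Tendsto (logRatio θ t₁ t₂ i) (farSector θ δ) (𝓝 0) := by
  have h1 : Tendsto (fun x : ℂ => 1 - canon θ t₁ t₂ i * x⁻¹) (farSector θ δ) (𝓝 1) := by
    simpa using ((tendsto_inv_of_le_cobounded (farSector_le θ δ)).const_mul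
      (canon θ t₁ t₂ i)).const_sub 1
  have h := (h1.clog one_mem_slitPlane).div_const 2
  rwa [log_one, zero_div] at h

theorem eventually_root_eq {θ δ : ℝ} (hδ : 0 < δ) (t₁ t₂ : ℂ) (i : Fin 2) :
    ∀ᶠ x in farSector θ δ, root θ t₁ t₂ i x
      = exp (logBranch θ x / 2) * exp (logRatio θ t₁ t₂ i x) := by
  filter_upwards [eventually_logBranch_sub hδ (canon θ t₁ t₂ i)] with x hx
  rw [root, hx.2, add_div, exp_add, logRatio]

theorem tendsto_root_mul_root_div {θ δ : ℝ} (hδ : 0 < δ) (t₁ t₂ : ℂ) :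
    Tendsto (fun x => root θ t₁ t₂ 0 x * root θ t₁ t₂ 1 x * x⁻¹) (farSector θ δ) (𝓝 1) := by
  have h1 : Tendsto (fun x => exp (logRatio θ t₁ t₂ 0 x + logRatio θ t₁ t₂ 1 x))
      (farSector θ δ) (𝓝 1) := by
    have h := ((tendsto_logRatio θ δ t₁ t₂ 0).add (tendsto_logRatio θ δ t₁ t₂ 1)).cexp
    rwa [add_zero, exp_zero] at h
  refine h1.congr' ?_
  filter_upwards [eventually_root_eq hδ t₁ t₂ 0, eventually_root_eq hδ t₁ t₂ 1,
    eventually_ne_zero_of_le_cobounded (farSector_le θ δ)] with x h0 h1 hx0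
  have hsq : exp (logBranch θ x / 2) * exp (logBranch θ x / 2) = x := by
    rw [← exp_add, add_halves, exp_logBranch θ hx0]
  rw [h0, h1, exp_add, mul_mul_mul_comm, hsq]
  field_simp

theorem tendsto_perBase_fst {θ δ : ℝ} (hδ : 0 < δ) (t₁ t₂ : ℂ) (i : Fin 2) :
    Tendsto (fun x => perBase θ t₁ t₂ i x 0 - logBranch θ x) (farSector θ δ)
      (𝓝 (-(logT θ t₂ / 2) + ![0, Real.pi * I] i)) := by
  have h1 : Tendsto (fun x => exp (logRatio θ t₁ t₂ 0 x) + exp (logRatio θ t₁ t₂ 1 x))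
      (farSector θ δ) (𝓝 2) := by
    have h := (tendsto_logRatio θ δ t₁ t₂ 0).cexp.add (tendsto_logRatio θ δ t₁ t₂ 1).cexp
    rw [exp_zero, one_add_one_eq_two] at h
    exact h
  have h2 : Tendsto (fun x => log (exp (logRatio θ t₁ t₂ 0 x) + exp (logRatio θ t₁ t₂ 1 x)))
      (farSector θ δ) (𝓝 (Real.log 2)) := by
    have h := h1.clog (ofNat_mem_slitPlane 2)
    rwa [show log (2 : ℂ) = Real.log 2 by rw [ofReal_log (by norm_num)]; norm_num] at h
  have h3 : Tendsto
      (fun x => (log (exp (logRatio θ t₁ t₂ 0 x) + exp (logRatio θ t₁ t₂ 1 x))).im)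
      (farSector θ δ) (𝓝 0) := by
    have h := (continuous_im.tendsto _).comp h2
    rwa [ofReal_im] at h
  have hlim := (((h2.const_mul 2).sub_const (2 * Real.log 2 : ℂ)).sub_const
    (logT θ t₂ / 2)).add_const (![0, Real.pi * I] i)
  rw [sub_self, zero_sub] at hlim
  refine hlim.congr' ?_
  have hpi := Real.pi_pos
  filter_upwards [eventually_root_eq hδ t₁ t₂ 0, eventually_root_eq hδ t₁ t₂ 1,
    h1.eventually_ne two_ne_zero, h3.eventually (Ioo_mem_nhds (a := -(Real.pi / 2))
      (b := Real.pi / 2) (by linarith) (by linarith))] with x hr0 hr1 hne him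
  have hsum : root θ t₁ t₂ 0 x + root θ t₁ t₂ 1 x = exp (logBranch θ x / 2 +
      log (exp (logRatio θ t₁ t₂ 0 x) + exp (logRatio θ t₁ t₂ 1 x))) := by
    rw [hr0, hr1, exp_add, exp_log hne]
    ring
  have hhalf : (logBranch θ x / 2).im = (logBranch θ x).im / 2 := by
    rw [show logBranch θ x / 2 = ((1 / 2 : ℝ) : ℂ) * logBranch θ x by push_cast; ring,
      im_ofReal_mul]
    ring
  have hl := logBranch_im_mem θ x
  simp only [perBase, Matrix.cons_val_zero]
  rw [hsum, logBranch_exp]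
  · ring
  · rw [add_im, hhalf]
    linarith [hl.1, him.1]
  · rw [add_im, hhalf]
    linarith [hl.2, him.2]

theorem isBigO_logBranch {θ : ℝ} {F : Filter ℂ} (hF : F ≤ Bornology.cobounded ℂ) :
    (logBranch θ) =O[F] fun x => ‖x‖ ^ (1 : ℤ) := by
  have hpi := Real.pi_pos
  refine IsBigO.of_bound (1 + (|θ| + 2 * Real.pi)) ?_
  have h1 : ∀ᶠ x : ℂ in F, 1 ≤ ‖x‖ :=
    hF (tendsto_norm_cobounded_atTop.eventually (eventually_ge_atTop 1))
  filter_upwards [h1] with x hx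
  have hx0 : x ≠ 0 := norm_pos_iff.1 (by linarith)
  have hre : (logBranch θ x).re = Real.log ‖x‖ := by
    conv_rhs => rw [← exp_logBranch θ hx0, norm_exp, Real.log_exp]
  have him := logBranch_im_mem θ x
  have h2 : |(logBranch θ x).re| ≤ ‖x‖ := by
    rw [hre, abs_of_nonneg (Real.log_nonneg hx)]
    exact Real.log_le_self (norm_nonneg x)
  have h3 : |(logBranch θ x).im| ≤ |θ| + 2 * Real.pi :=
    abs_le.2 ⟨by linarith [him.1, neg_abs_le θ], by linarith [him.2, le_abs_self θ]⟩
  rw [zpow_one, norm_norm]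
  calc ‖logBranch θ x‖ ≤ |(logBranch θ x).re| + |(logBranch θ x).im| := norm_le_abs_re_add_abs_im _
    _ ≤ 1 * ‖x‖ + (|θ| + 2 * Real.pi) * ‖x‖ := by
        gcongr
        · linarith
        · exact h3.trans (le_mul_of_one_le_right (by positivity) hx)
    _ = (1 + (|θ| + 2 * Real.pi)) * ‖x‖ := by ring

theorem isBigO_perInfty (θ δ : ℝ) (ψ : ℂ) (i : Fin 2) (l : ℤ) (a : Fin 2) :
    (fun x => perInfty θ ψ i l x a) =O[farSector θ δ] fun x => ‖x‖ ^ (-l) := by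
  have hF := farSector_le θ δ
  have h := isBigO_of_sourcedEquation (t₁ := 0) (t₂ := 0) (K := 0) hF (X := perInfty θ ψ i)
    (Y := fun _ _ => 0) (fun n => ?_) (fun n a => isBigO_zero _ _) (fun a => ?_) l a
  · simpa using h
  · filter_upwards [eventually_ne_zero_of_le_cobounded hF] with x hx
    constructor
    · have := perInfty_fst θ ψ i n hx
      simp only [Pi.zero_apply]
      linear_combination this
    · have := perInfty_snd θ ψ i n hx
      simp only [Pi.zero_apply]
      linear_combination this
  · simp only [perInfty_neg_one, sub_zero]
    fin_cases a
    · exact (isBigO_zpow_mono hF (isBigO_const_zpow _) zero_le_one).add (isBigO_logBranch hF)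
    · refine (isBigO_id_zpow.const_mul_left (2⁻¹ : ℂ)).congr_left fun x => ?_
      simp only [Fin.mk_one, Matrix.cons_val_one, Matrix.cons_val_fin_one]
      ring

/-! ### The remainder of the asymptotic expansion -/

/-- The remainder `I^{(n)} - ∑_{k < K} (-1)^k S_k I^{(n+k)}_∞`. -/
def remainder (θ : ℝ) (t₁ t₂ ψ : ℂ) (i : Fin 2) (K : ℕ) (n : ℤ) (x : ℂ) : C2 :=
  period θ t₁ t₂ i n x - ∑ k ∈ Finset.range K,
    (-1 : ℂ) ^ k • (calibration θ t₁ t₂ ψ k).mulVec (perInfty θ ψ i (n + k) x)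

theorem remainder_succ (θ : ℝ) (t₁ t₂ ψ : ℂ) (i : Fin 2) (K : ℕ) (n : ℤ) (x : ℂ) (a : Fin 2) :
    remainder θ t₁ t₂ ψ i (K + 1) n x a = remainder θ t₁ t₂ ψ i K n x a
      - (-1) ^ K * (calibration θ t₁ t₂ ψ K a 0 * perInfty θ ψ i (n + K) x 0
        + calibration θ t₁ t₂ ψ K a 1 * perInfty θ ψ i (n + K) x 1) := by
  rw [remainder, remainder, Finset.sum_range_succ]
  simp only [Pi.sub_apply, Pi.add_apply, Pi.smul_apply, smul_eq_mul, Matrix.mulVec, dotProduct,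
    Fin.sum_univ_two]
  ring

/-- The term `(-1)^K (K S_K + S_K μ - μ S_K) I^{(n+K)}_∞` by which the remainder fails to satisfy
the period equation. -/
def source (θ : ℝ) (t₁ t₂ ψ : ℂ) (i : Fin 2) (K : ℕ) (n : ℤ) (x : ℂ) : C2 :=
  ![(-1) ^ K * (K * calibration θ t₁ t₂ ψ K 0 0 * perInfty θ ψ i (n + K) x 0
      + (K - 1) * calibration θ t₁ t₂ ψ K 0 1 * perInfty θ ψ i (n + K) x 1),
    (-1) ^ K * ((K + 1) * calibration θ t₁ t₂ ψ K 1 0 * perInfty θ ψ i (n + K) x 0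
      + K * calibration θ t₁ t₂ ψ K 1 1 * perInfty θ ψ i (n + K) x 1)]

theorem calibration_rec_entries (θ : ℝ) (t₁ t₂ ψ : ℂ) (k : ℕ) :
    ((k : ℂ) + 1) * calibration θ t₁ t₂ ψ (k + 1) 0 0
        = t₁ * calibration θ t₁ t₂ ψ k 0 0 + 2 * calibration θ t₁ t₂ ψ k 1 0 ∧
    (k : ℂ) * calibration θ t₁ t₂ ψ (k + 1) 0 1
        = t₁ * calibration θ t₁ t₂ ψ k 0 1 + 2 * calibration θ t₁ t₂ ψ k 1 1
          - 2 * calibration θ t₁ t₂ ψ k 0 0 ∧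
    ((k : ℂ) + 2) * calibration θ t₁ t₂ ψ (k + 1) 1 0
        = 2 * t₂ * calibration θ t₁ t₂ ψ k 0 0 + t₁ * calibration θ t₁ t₂ ψ k 1 0 ∧
    ((k : ℂ) + 1) * calibration θ t₁ t₂ ψ (k + 1) 1 1
        = 2 * t₂ * calibration θ t₁ t₂ ψ k 0 1 + t₁ * calibration θ t₁ t₂ ψ k 1 1
          - 2 * calibration θ t₁ t₂ ψ k 1 0 := by
  have h := fun a b => congrFun (congrFun (calibration_rec θ t₁ t₂ ψ k) a) b
  have h00 := h 0 0
  have h01 := h 0 1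
  have h10 := h 1 0
  have h11 := h 1 1
  simp only [Matrix.sub_apply, Matrix.add_apply, Matrix.smul_apply, Matrix.mul_apply,
    Fin.sum_univ_two, smul_eq_mul, UMat, muMat, RMat, Matrix.of_apply, Matrix.cons_val_zero,
    Matrix.cons_val_one, Matrix.cons_val_fin_one, Matrix.cons_val', mul_zero, zero_mul, add_zero,
    zero_add, sub_zero] at h00 h01 h10 h11
  refine ⟨?_, ?_, ?_, ?_⟩
  · linear_combination h00
  · linear_combination h01
  · linear_combination h10
  · linear_combination h11

/-- The period equation of the remainder. The sources telescope because of the recursion for the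
calibration and the equation `(R - λ) I^{(l+1)}_∞ = (μ + l + 1/2) I^{(l)}_∞`. -/
theorem remainder_equation {θ : ℝ} {t₁ t₂ : ℂ} (ψ : ℂ) (ht : t₂ ∈ cutPlane (2 * θ)) (i : Fin 2)
    (K : ℕ) (n : ℤ) {x : ℂ} (hx : x ∈ cutLambda θ t₁ t₂) (hx0 : x ≠ 0) :
    (t₁ - x) * remainder θ t₁ t₂ ψ i K (n + 1) x 0 + 2 * remainder θ t₁ t₂ ψ i K (n + 1) x 1
        = (n + 1) * remainder θ t₁ t₂ ψ i K n x 0 + source θ t₁ t₂ ψ i K n x 0 ∧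
    2 * t₂ * remainder θ t₁ t₂ ψ i K (n + 1) x 0
        + (t₁ - x) * remainder θ t₁ t₂ ψ i K (n + 1) x 1
        = n * remainder θ t₁ t₂ ψ i K n x 1 + source θ t₁ t₂ ψ i K n x 1 := by
  induction K with
  | zero =>
    have h1 := (isLevel_period (t₁ := t₁) ht i n).fst x hx
    have h2 := (isLevel_period (t₁ := t₁) ht i n).snd x hx
    simp [remainder, source, calibration_zero]
    exact ⟨h1, h2⟩
  | succ K ih =>
    obtain ⟨ih1, ih2⟩ := ih
    obtain ⟨c00, c01, c10, c11⟩ := calibration_rec_entries θ t₁ t₂ ψ K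
    have p0 := perInfty_fst θ ψ i (n + K) hx0
    have p1 := perInfty_snd θ ψ i (n + K) hx0
    simp only [source, Matrix.cons_val_zero, Matrix.cons_val_one,
      Matrix.cons_val_fin_one] at ih1 ih2 ⊢
    simp only [remainder_succ]
    rw [show n + 1 + (K : ℤ) = n + K + 1 by ring,
      show n + ((K + 1 : ℕ) : ℤ) = n + K + 1 by push_cast; ring]
    push_cast at p0 p1 ⊢
    constructor
    · linear_combination ih1 - (-1) ^ K * calibration θ t₁ t₂ ψ K 0 0 * p0
        - (-1) ^ K * calibration θ t₁ t₂ ψ K 0 1 * p1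
        + (-1) ^ K * perInfty θ ψ i (n + K + 1) x 0 * c00
        + (-1) ^ K * perInfty θ ψ i (n + K + 1) x 1 * c01
    · linear_combination ih2 - (-1) ^ K * calibration θ t₁ t₂ ψ K 1 0 * p0
        - (-1) ^ K * calibration θ t₁ t₂ ψ K 1 1 * p1
        + (-1) ^ K * perInfty θ ψ i (n + K + 1) x 0 * c10
        + (-1) ^ K * perInfty θ ψ i (n + K + 1) x 1 * c11

theorem isBigO_source (θ δ : ℝ) (t₁ t₂ ψ : ℂ) (i : Fin 2) (K : ℕ) (n : ℤ) (a : Fin 2) :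
    (fun x => source θ t₁ t₂ ψ i K n x a) =O[farSector θ δ] fun x => ‖x‖ ^ (-(n + K)) := by
  have h0 := isBigO_perInfty θ δ ψ i (n + K) 0
  have h1 := isBigO_perInfty θ δ ψ i (n + K) 1
  fin_cases a
  · exact ((h0.const_mul_left _).add (h1.const_mul_left _)).const_mul_left _
  · exact ((h0.const_mul_left _).add (h1.const_mul_left _)).const_mul_left _

theorem hasDerivAt_remainder {θ : ℝ} {t₁ t₂ : ℂ} (ψ : ℂ) (ht : t₂ ∈ cutPlane (2 * θ))
    (i : Fin 2) (K : ℕ) (a : Fin 2) {x : ℂ} (hx : x ∈ cutLambda θ t₁ t₂)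
    (hx' : x ∈ cutPlane θ) :
    HasDerivAt (fun x => remainder θ t₁ t₂ ψ i K (-1) x a) (remainder θ t₁ t₂ ψ i K 0 x a) x := by
  induction K with
  | zero =>
    have h := (isLevel_period (t₁ := t₁) ht i (-1)).apply hx a
    simpa [remainder] using h
  | succ K ih =>
    simp only [remainder_succ]
    exact ih.sub ((((hasDerivAt_perInfty ψ i K 0 hx').const_mul _).add
      ((hasDerivAt_perInfty ψ i K 1 hx').const_mul _)).const_mul _)

theorem isBigO_remainder_step (θ δ : ℝ) (t₁ t₂ ψ : ℂ) (i : Fin 2) (K : ℕ) (n : ℤ) (a : Fin 2) :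
    (fun x => (-1) ^ K * (calibration θ t₁ t₂ ψ K a 0 * perInfty θ ψ i (n + K) x 0
        + calibration θ t₁ t₂ ψ K a 1 * perInfty θ ψ i (n + K) x 1))
      =O[farSector θ δ] fun x => ‖x‖ ^ (-(n + K)) :=
  (((isBigO_perInfty θ δ ψ i (n + K) 0).const_mul_left _).add
    ((isBigO_perInfty θ δ ψ i (n + K) 1).const_mul_left _)).const_mul_left _

theorem tendsto_zero_of_isBigO {F : Filter ℂ} (hF : F ≤ Bornology.cobounded ℂ) {f : ℂ → ℂ}
    (hf : f =O[F] fun x => ‖x‖ ^ (-1 : ℤ)) : Tendsto f F (𝓝 0) := by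
  refine hf.trans_tendsto ?_
  simp only [zpow_neg_one]
  exact tendsto_inv_atTop_zero.comp (tendsto_norm_cobounded_atTop.mono_left hF)

/-- At level `-1` two terms of the expansion suffice to cancel everything that does not tend to
zero; the entry `(S_1)_{12} = ψ + log t₂` matches the constant terms. -/
theorem tendsto_remainder {θ δ : ℝ} (hδ : 0 < δ) (t₁ t₂ ψ : ℂ) (i : Fin 2) {K : ℕ}
    (hK : 2 ≤ K) :
    Tendsto (fun x => remainder θ t₁ t₂ ψ i K (-1) x 0) (farSector θ δ) (𝓝 0) ∧
    Tendsto (fun x => remainder θ t₁ t₂ ψ i K (-1) x 1 * x⁻¹) (farSector θ δ) (𝓝 0) := by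
  have hF := farSector_le θ δ
  have hinv := tendsto_inv_of_le_cobounded hF
  induction K, hK using Nat.le_induction with
  | base =>
    have hS := calibration_one θ t₁ t₂ ψ
    have hr : ∀ x a, remainder θ t₁ t₂ ψ i 2 (-1) x a
        = perBase θ t₁ t₂ i x a - perInfty θ ψ i (-1) x a
          + (calibration θ t₁ t₂ ψ 1 a 0 * x⁻¹ + calibration θ t₁ t₂ ψ 1 a 1 * (1 / 2)) := by
      intro x a
      rw [remainder_succ, remainder_succ, calibration_zero]
      simp only [remainder, Finset.range_zero, Finset.sum_empty, sub_zero, period_neg_one]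
      rw [show (-1 : ℤ) + ((1 : ℕ) : ℤ) = 0 by norm_num,
        show (-1 : ℤ) + ((0 : ℕ) : ℤ) = -1 by norm_num, perInfty_zero]
      obtain rfl | rfl : a = 0 ∨ a = 1 := by fin_cases a <;> simp
      all_goals
        simp
        ring
    constructor
    · have h := ((tendsto_perBase_fst hδ t₁ t₂ i).sub_const (perInftyConst ψ i)).add
        ((hinv.const_mul (calibration θ t₁ t₂ ψ 1 0 0)).add_const
          (calibration θ t₁ t₂ ψ 1 0 1 * (1 / 2)))
      have hzero : -(logT θ t₂ / 2) + ![0, Real.pi * I] i - perInftyConst ψ i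
          + (calibration θ t₁ t₂ ψ 1 0 0 * 0 + calibration θ t₁ t₂ ψ 1 0 1 * (1 / 2)) = 0 := by
        rw [hS, perInftyConst]; ring
      rw [hzero] at h
      refine h.congr fun x => ?_
      rw [hr, perInfty_neg_one, Matrix.cons_val_zero]
      ring
    · have h := (((tendsto_root_mul_root_div hδ t₁ t₂).div_const 2).sub_const (1 / 2)).add
        (((hinv.const_mul (calibration θ t₁ t₂ ψ 1 1 0)).add_const
          (calibration θ t₁ t₂ ψ 1 1 1 * (1 / 2))).mul hinv)
      rw [mul_zero, add_zero, sub_self] at h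
      refine h.congr' ?_
      filter_upwards [eventually_ne_zero_of_le_cobounded hF] with x hx
      rw [hr, perInfty_neg_one]
      simp only [perBase, Matrix.cons_val_one, Matrix.cons_val_fin_one]
      field_simp
  | succ K hK ih =>
    have hstep : ∀ a, Tendsto (fun x => (-1) ^ K * (calibration θ t₁ t₂ ψ K a 0 *
        perInfty θ ψ i (-1 + K) x 0 + calibration θ t₁ t₂ ψ K a 1 * perInfty θ ψ i (-1 + K) x 1))
        (farSector θ δ) (𝓝 0) := fun a =>
      tendsto_zero_of_isBigO hF (isBigO_zpow_mono hF
        (isBigO_remainder_step θ δ t₁ t₂ ψ i K (-1) a) (by omega))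
    constructor
    · simp only [remainder_succ]
      simpa using ih.1.sub (hstep 0)
    · simp only [remainder_succ, sub_mul]
      simpa using ih.2.sub ((hstep 1).mul hinv)

theorem hasDerivAt_root_mul_root {θ : ℝ} {t₁ t₂ x : ℂ} (hx : x ∈ cutLambda θ t₁ t₂) :
    HasDerivAt (fun x => root θ t₁ t₂ 0 x * root θ t₁ t₂ 1 x)
      ((x - t₁) / (root θ t₁ t₂ 0 x * root θ t₁ t₂ 1 x)) x := by
  have h := (hasDerivAt_pi.1 (hasDerivAt_perBase 0 hx) 1).const_mul 2
  have h0 := root_ne_zero θ t₁ t₂ 0 x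
  have h1 := root_ne_zero θ t₁ t₂ 1 x
  simp only [perBase, Matrix.cons_val_one, Matrix.cons_val_fin_one] at h
  refine (h.congr_deriv ?_).congr_of_eventuallyEq (Eventually.of_forall fun y => ?_)
  · field_simp
  · ring

/-- The bound of the remainder at level `-1`. After division by `√((λ - u¹)(λ - u²))` the second
component has a small derivative, so it is integrated from infinity; then the derivative of the
first component is small as well. -/
theorem isBigO_remainder_neg_one {θ δ : ℝ} (hδ : 0 < δ) {t₁ t₂ : ℂ} (ψ : ℂ)
    (ht : t₂ ∈ cutPlane (2 * θ)) (i : Fin 2) {K : ℕ} (hK : 2 ≤ K) (a : Fin 2) :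
    (fun x => remainder θ t₁ t₂ ψ i K (-1) x a) =O[farSector θ δ] fun x => ‖x‖ ^ (1 - (K : ℤ)) := by
  have hF := farSector_le θ δ
  obtain ⟨hlim0, hlim1⟩ := tendsto_remainder hδ t₁ t₂ ψ i hK
  have hs : ∀ a, (fun x => source θ t₁ t₂ ψ i K (-1) x a) =O[farSector θ δ]
      fun x => ‖x‖ ^ (1 - (K : ℤ)) := fun a =>
    isBigO_zpow_mono hF (isBigO_source θ δ t₁ t₂ ψ i K (-1) a) (by linarith)
  have hw := isBigO_sub_id_zpow hF t₁
  have hD := isBigO_inv_disc hF t₁ t₂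
  have hwD := isBigO_mul_zpow hF hw hD (c := -1) (by norm_num)
  set Δ : ℂ → ℂ := fun x => root θ t₁ t₂ 0 x * root θ t₁ t₂ 1 x with hΔ
  have hΔ0 : ∀ x, Δ x ≠ 0 := fun x => mul_ne_zero (root_ne_zero _ _ _ _ _) (root_ne_zero _ _ _ _ _)
  have hΔlim : Tendsto (fun x => Δ x * x⁻¹) (farSector θ δ) (𝓝 1) :=
    tendsto_root_mul_root_div hδ t₁ t₂
  have hΔO : Δ =O[farSector θ δ] fun x => ‖x‖ ^ (1 : ℤ) := by
    refine (isBigO_mul_zpow hF (isBigO_of_tendsto hΔlim) isBigO_id_zpow (c := 1) rfl).congr' ?_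
      EventuallyEq.rfl
    filter_upwards [eventually_ne_zero_of_le_cobounded hF] with x hx
    rw [inv_mul_cancel_right₀ hx]
  have hΔinv : (fun x => (Δ x)⁻¹) =O[farSector θ δ] fun x => ‖x‖ ^ (-1 : ℤ) := by
    refine (isBigO_mul_zpow hF (isBigO_of_tendsto (hΔlim.inv₀ one_ne_zero)) isBigO_inv_zpow
      (c := -1) rfl).congr' ?_ EventuallyEq.rfl
    filter_upwards [eventually_ne_zero_of_le_cobounded hF] with x hx
    have := hΔ0 x
    field_simp
  have hgood : ∀ᶠ x in farSector θ δ, x ∈ cutLambda θ t₁ t₂ ∧ x ∈ cutPlane θ ∧ x ≠ 0 :=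
    (eventually_mem_cutLambda hδ t₁ t₂).and
      ((eventually_mem_cutPlane hδ).and (eventually_ne_zero_of_le_cobounded hF))
  have hK' : (2 : ℤ) ≤ K := by exact_mod_cast hK
  have hsnd : (fun x => remainder θ t₁ t₂ ψ i K (-1) x 1) =O[farSector θ δ]
      fun x => ‖x‖ ^ (1 - (K : ℤ)) := by
    have hq : (fun x => remainder θ t₁ t₂ ψ i K (-1) x 1 * (Δ x)⁻¹) =O[farSector θ δ]
        fun x => ‖x‖ ^ (-(K : ℤ)) := by
      refine isBigO_of_hasDerivAt (f' := fun x => ((t₁ - x) * ((t₁ - x) ^ 2 - 4 * t₂)⁻¹ *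
        source θ t₁ t₂ ψ i K (-1) x 1 - 2 * t₂ * (((t₁ - x) ^ 2 - 4 * t₂)⁻¹ *
        source θ t₁ t₂ ψ i K (-1) x 0)) * (Δ x)⁻¹) (by linarith) ?_ ?_ ?_
      · filter_upwards [hgood] with x hx
        obtain ⟨hcut, hcut', hx0⟩ := hx
        have h1 := (hasDerivAt_remainder ψ ht i K 1 hcut hcut').mul
          ((hasDerivAt_root_mul_root hcut).inv (hΔ0 x))
        refine h1.congr_deriv ?_
        obtain ⟨e0, e1⟩ := remainder_equation ψ ht i K (-1) hcut hx0
        rw [neg_add_cancel] at e0 e1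
        push_cast at e0 e1
        have hsq : Δ x ^ 2 = (t₁ - x) ^ 2 - 4 * t₂ := root_mul_sq ht hcut
        have hDne := disc_ne_zero ht hcut
        have hne := hΔ0 x
        change _ * (Δ x)⁻¹ + _ * (-((x - t₁) / Δ x) / Δ x ^ 2) = _
        have h2 : -((x - t₁) / Δ x) / Δ x ^ 2
            = (t₁ - x) * ((t₁ - x) ^ 2 - 4 * t₂)⁻¹ * (Δ x)⁻¹ := by
          rw [hsq]; field_simp; ring
        rw [h2]
        have h3 : remainder θ t₁ t₂ ψ i K 0 x 1
            + remainder θ t₁ t₂ ψ i K (-1) x 1 * ((t₁ - x) * ((t₁ - x) ^ 2 - 4 * t₂)⁻¹)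
            = (t₁ - x) * ((t₁ - x) ^ 2 - 4 * t₂)⁻¹ * source θ t₁ t₂ ψ i K (-1) x 1
              - 2 * t₂ * (((t₁ - x) ^ 2 - 4 * t₂)⁻¹ * source θ t₁ t₂ ψ i K (-1) x 0) := by
          field_simp
          linear_combination (t₁ - x) * e1 - 2 * t₂ * e0
        rw [← h3]
        ring
      · refine isBigO_mul_zpow hF (a := -(K : ℤ)) ?_ hΔinv (by ring)
        exact (isBigO_mul_zpow hF hwD (hs 1) (by ring)).sub
          ((isBigO_zpow_mono hF (isBigO_mul_zpow hF hD (hs 0) rfl) (by linarith)).const_mul_left _)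
      · have h := hlim1.mul (hΔlim.inv₀ one_ne_zero)
        rw [zero_mul] at h
        refine h.congr' ?_
        filter_upwards [hgood] with x hx
        have hx0 := hx.2.2
        have := hΔ0 x
        field_simp
    refine (isBigO_mul_zpow hF hq hΔO (c := 1 - (K : ℤ)) (by ring)).congr_left fun x => ?_
    rw [inv_mul_cancel_right₀ (hΔ0 x)]
  have hfst : (fun x => remainder θ t₁ t₂ ψ i K (-1) x 0) =O[farSector θ δ]
      fun x => ‖x‖ ^ (1 - (K : ℤ)) := by
    have h := isBigO_of_hasDerivAt (θ := θ) (δ := δ) (N := (K : ℤ) - 1)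
      (f := fun x => remainder θ t₁ t₂ ψ i K (-1) x 0)
      (f' := fun x => remainder θ t₁ t₂ ψ i K 0 x 0) (by linarith) ?_ ?_ hlim0
    · simpa using h
    · filter_upwards [hgood] with x hx
      exact hasDerivAt_remainder ψ ht i K 0 hx.1 hx.2.1
    · rw [sub_add_cancel]
      refine ((isBigO_mul_zpow hF hwD (hs 0) (c := -(K : ℤ)) (by ring)).sub
        (isBigO_zpow_mono hF ((isBigO_mul_zpow hF hD ((hs 1).sub hsnd) rfl).const_mul_left 2)
          (by linarith))).congr' ?_ EventuallyEq.rfl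
      filter_upwards [hgood] with x hx
      obtain ⟨e0, e1⟩ := remainder_equation ψ ht i K (-1) hx.1 hx.2.2
      rw [neg_add_cancel] at e0 e1
      push_cast at e0 e1
      have hDne := disc_ne_zero ht hx.1
      field_simp
      linear_combination 2 * e1 - (t₁ - x) * e0
  fin_cases a
  exacts [hfst, hsnd]

theorem isBigO_remainder {θ δ : ℝ} (hδ : 0 < δ) {t₁ t₂ : ℂ} (ψ : ℂ)
    (ht : t₂ ∈ cutPlane (2 * θ)) (i : Fin 2) (K : ℕ) (n : ℤ) (a : Fin 2) :
    (fun x => remainder θ t₁ t₂ ψ i K n x a) =O[farSector θ δ] fun x => ‖x‖ ^ (-(n + K)) := by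
  have hF := farSector_le θ δ
  have hlarge : ∀ K : ℕ, 2 ≤ K → (fun x => remainder θ t₁ t₂ ψ i K n x a) =O[farSector θ δ]
      fun x => ‖x‖ ^ (-(n + K)) := by
    intro K hK
    refine isBigO_of_sourcedEquation (t₁ := t₁) (t₂ := t₂) hF (X := remainder θ t₁ t₂ ψ i K)
      (Y := source θ t₁ t₂ ψ i K) (fun n => ?_) (isBigO_source θ δ t₁ t₂ ψ i K)
      (isBigO_remainder_neg_one hδ ψ ht i hK) n a
    filter_upwards [eventually_mem_cutLambda hδ t₁ t₂,
      eventually_ne_zero_of_le_cobounded hF] with x hx hx0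
    exact remainder_equation ψ ht i K n hx hx0
  have hstep : ∀ K : ℕ, ((fun x => remainder θ t₁ t₂ ψ i (K + 1) n x a) =O[farSector θ δ]
      fun x => ‖x‖ ^ (-(n + ((K + 1 : ℕ) : ℤ)))) →
      (fun x => remainder θ t₁ t₂ ψ i K n x a) =O[farSector θ δ] fun x => ‖x‖ ^ (-(n + K)) := by
    intro K h
    refine ((isBigO_zpow_mono hF h (by push_cast; linarith)).add
      (isBigO_remainder_step θ δ t₁ t₂ ψ i K n a)).congr_left fun x => ?_
    rw [remainder_succ, sub_add_cancel]
  match K with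
  | 0 => exact hstep 0 (hstep 1 (hlarge 2 le_rfl))
  | 1 => exact hstep 1 (hlarge 2 le_rfl)
  | K + 2 => exact hlarge (K + 2) (by omega)

theorem loopElement_sub_sum_eq {θ : ℝ} {t₁ t₂ ψ : ℂ} {per : Fin 2 → ℤ → ℂ → C2} (a : C2) (n : ℤ)
    (K : ℕ) {x : ℂ} (hper : ∀ i, per i n x = period θ t₁ t₂ i n x) :
    loopElement per a n x - ∑ k ∈ Finset.range K,
        (calibration θ t₁ t₂ ψ k).mulVec (loopElement (perInfty θ ψ) a (n + k) x)
      = (-1 : ℂ) ^ n • ∑ i, a i • remainder θ t₁ t₂ ψ i K n x := by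
  have hterm : ∀ k : ℕ, (calibration θ t₁ t₂ ψ k).mulVec (loopElement (perInfty θ ψ) a (n + k) x)
      = (-1 : ℂ) ^ n • ∑ i, a i • (-1 : ℂ) ^ k •
        (calibration θ t₁ t₂ ψ k).mulVec (perInfty θ ψ i (n + k) x) := by
    intro k
    rw [loopElement, Matrix.mulVec_smul, zpow_add₀ (by norm_num), zpow_natCast, mul_smul]
    simp only [Fin.sum_univ_two, Matrix.mulVec_add, Matrix.mulVec_smul, smul_add]
    rw [smul_comm (a 0), smul_comm (a 1)]
  rw [Finset.sum_congr rfl fun k _ => hterm k]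
  simp only [loopElement, hper, remainder, Fin.sum_univ_two, smul_sub, Finset.smul_sum,
    smul_add, Finset.sum_add_distrib]
  abel

end Catalan

end

theorem mainTheorem10 (θ : ℝ) (t₁ t₂ ψ : ℂ) (ht : t₂ ∈ Catalan.cutPlane (2 * θ)) :
    (∃ per : Fin 2 → ℤ → ℂ → Catalan.C2,
      ∀ i l, Catalan.IsPeriodVector θ t₁ t₂ i l (per i l)) ∧
    ∀ per : Fin 2 → ℤ → ℂ → Catalan.C2,
      (∀ i l, Catalan.IsPeriodVector θ t₁ t₂ i l (per i l)) →
      ∀ a : Catalan.C2,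
        Catalan.AsymptoticAtInfinity θ (Catalan.loopElement per a)
          (Catalan.calibration θ t₁ t₂ ψ)
          (Catalan.loopElement (Catalan.perInfty θ ψ) a) := by
  refine ⟨⟨Catalan.period θ t₁ t₂, fun i l => Catalan.isPeriodVector_period ht i l⟩,
    fun per hper a δ hδ n K => ?_⟩
  have h : (fun x => (-1 : ℂ) ^ n • ∑ i, a i • Catalan.remainder θ t₁ t₂ ψ i K n x)
      =O[Catalan.farSector θ δ] fun x => ‖x‖ ^ (-(n + (K : ℤ))) := by
    have hr : ∀ i, (fun x => Catalan.remainder θ t₁ t₂ ψ i K n x)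
        =O[Catalan.farSector θ δ] fun x => ‖x‖ ^ (-(n + (K : ℤ))) := fun i =>
      isBigO_pi.2 fun b => Catalan.isBigO_remainder hδ ψ ht i K n b
    simp only [Fin.sum_univ_two]
    exact (((hr 0).const_smul_left (a 0)).add ((hr 1).const_smul_left (a 1))).const_smul_left
      ((-1 : ℂ) ^ n)
  refine h.congr' ?_ EventuallyEq.rfl
  filter_upwards [Catalan.eventually_mem_cutLambda hδ t₁ t₂] with x hx
  exact (Catalan.loopElement_sub_sum_eq a n K fun i => (hper i n).eq_period ht x hx).symm
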